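/- Let $d\ge 3$, let $T_d$ be the infinite $d$-regular tree, and for a finite set $S$ let $I_d(S)$ be the set of probability measures on $S^{V(T_d)}$ that are invariant under all automorphisms of $T_d$. Definitions. A sequence of finite $d$-regular graphs $(G_i)$ is a large girth sequence if for every $\varepsilon>0$ and all large $i$, a uniform random vertex of $G_i$ lies on a cycle of length at most $\lceil 1/\varepsilon\rceil$ with probability at most $\varepsilon$. A process $\mu\in I_d(S)$ is a Benjamini–Schramm limit of colorings of such a sequence if there are $f_i:V(G_i)\to S$ such that for every $r\in\mathbb N$ the law of the isomorphism class of the rooted $S$-colored $r$-neighborhood of a uniform random vertex of $(G_i,f_i)$ converges to the law of the isomorphism class of the $\mu$-randomly colored $r$-neighborhood of a vertex of $T_d$. The process $\mu$ is typical if for some fixed sequence $(n_i)$ of integers for which $d$-regular graphs on $n_i$ vertices exist, and independent uniform random $d$-regular simple graphs $\mathbb G_{n_i}$ on $n_i$ labelled vertices, with probability $1$ the sequence $(\mathbb G_{n_i})_i$ is a large girth sequence and $\mu$ is a Benjamini–Schramm limit of colorings of it. Let $C$ be a star in $T_d$ with root $o$ and leaves $w_1,\dots,w_d$. The process $\mu$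 is rigid if (1) for $\mu$-almost every $f$ the values of $f$ on $C\setminus\{w_1\}$ determine $f(w_1)$, i.e. $f(w_1)=F(f|_{C\setminus\{w_1\}})$ almost surely for some function $F$, and (2) under $\mu$ the values $f(v)$, $v\in C\setminus\{w_1\}$, are not independent and identically distributed. (By invariance these notions do not depend on the chosen vertex or star.) Proposition. (a) If $S$ is a finite set and $\mu\in I_d(S)$ is rigid, then $\mu$ is not typical. (b) If $S\subset\mathbb R$ is finite, $\mu\in I_d(S)$ is typical, and for some $\lambda\in\mathbb R$ a $\mu$-random function $f$ satisfies $\lambda f(o)=f(w_1)+\dots+f(w_d)$ with probability $1$, then $f$ is almost surely equal to one deterministic constant; that is, a typical process satisfying an eigenvector equation cannot take only finitely many values, unless it is a deterministic constant. -/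

import Mathlib

open MeasureTheory ProbabilityTheory Filter Topology

/-! ### Invariant processes on a tree -/

/-- The `S`-valued random processes indexed by the vertices of `T` (probability measures on
`V → S`) whose law is invariant under all automorphisms of `T`: the new label of a vertex is the
old label of its inverse image. -/
def invariantProcesses {V : Type*} (T : SimpleGraph V) (S : Type*) [MeasurableSpace S] :
    Set (Measure (V → S)) :=
  {μ | IsProbabilityMeasure μ ∧
    ∀ φ : T ≃g T, μ.map (fun (f : V → S) (v : V) => f (φ.symm v)) = μ}

/-! ### Local statistics of colorings and Benjamini–Schramm limits -/

/-- Vertices at graph distance at most `r` from `v`. -/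
def closedGraphBall {V : Type*} (G : SimpleGraph V) (v : V) (r : ℕ) : Set V :=
  {w | G.edist v w ≤ r}

/-- The neighborhood of radius `r` of `v` in `G` (an induced subgraph, rooted at `v`, colored by
`f`) is isomorphic, as a rooted colored graph, to the neighborhood of radius `r` of `w` in `H`,
colored by `g`. -/
def SameColoredBall {V W S : Type*} (r : ℕ) (G : SimpleGraph V) (v : V) (f : V → S)
    (H : SimpleGraph W) (w : W) (g : W → S) : Prop :=
  ∃ e : G.induce (closedGraphBall G v r) ≃g H.induce (closedGraphBall H w r),
    (∀ x : closedGraphBall G v r, (x : V) = v ↔ (e x : W) = w) ∧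
      ∀ x : closedGraphBall G v r, g (e x) = f x

/-- The colored finite graphs `(G i, f i)` Benjamini–Schramm converge to the process `μ` on `T`:
for every radius `r` the law of the colored `r`-neighborhood of a uniform random vertex of `G i`
converges to the law of the colored `r`-neighborhood of the root `o` of `T` under `μ`. Here `c`
ranges over the possible colored neighborhoods of the root in `T`. As their probabilities under `μ`
add up to `1`, convergence of the probability of each of them is convergence in law.
The root is arbitrary, since `μ` will be invariant and `T` vertex transitive. -/
def BenjaminiSchrammConverges {V S : Type*} [MeasurableSpace S] (T : SimpleGraph V)
    {n : ℕ → ℕ} (G : ∀ i, SimpleGraph (Fin (n i))) (f : ∀ i, Fin (n i) → S)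
    (μ : Measure (V → S)) : Prop :=
  ∀ (o : V) (r : ℕ) (c : V → S),
    Tendsto (fun i => ({v | SameColoredBall r (G i) v (f i) T o c}.ncard : ℝ) / n i) atTop
      (𝓝 (μ.real {ω | SameColoredBall r T o ω T o c}))

/-- Large girth sequence: for every `ε > 0`, from some index on, the probability that a random
vertex lies on a cycle of length at most `⌈1/ε⌉` is at most `ε`. -/
def IsLargeGirthSequence {n : ℕ → ℕ} (G : ∀ i, SimpleGraph (Fin (n i))) : Prop :=
  ∀ ε : ℝ, 0 < ε → ∀ᶠ i in atTop,
    ({v | ∃ p : (G i).Walk v v, p.IsCycle ∧ p.length ≤ ⌈1 / ε⌉₊}.ncard : ℝ) / n i ≤ ε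

/-- The set of `S`-valued invariant processes on `T` that arise as Benjamini–Schramm limits of
`S`-colorings of the large girth sequence `G`. -/
def profile {V : Type*} (T : SimpleGraph V) (S : Type*) [MeasurableSpace S]
    {n : ℕ → ℕ} (G : ∀ i, SimpleGraph (Fin (n i))) : Set (Measure (V → S)) :=
  {μ | μ ∈ invariantProcesses T S ∧ IsLargeGirthSequence G ∧
    ∃ f : ∀ i, Fin (n i) → S, BenjaminiSchrammConverges T G f μ}

/-! ### Typical processes -/

open Classical in
/-- The set of `d`-regular simple graphs on the vertex set `{0, …, n - 1}`. -/
def regularGraphs (d n : ℕ) : Set (SimpleGraph (Fin n)) :=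
  {G | G.IsRegularOfDegree d}

/-- `μ` is typical: there is a fixed sequence `n 0, n 1, …` (of sizes for which `d`-regular graphs
exist) such that, for independent uniformly random `d`-regular graphs `G i` on `n i` vertices,
`μ` lies in the profile of the sequence `G` with probability one.
(Benjamini–Schramm convergence to a process on an infinite tree forces `n i → ∞`.) -/
def IsTypical {V : Type*} (T : SimpleGraph V) (d : ℕ) {S : Type*} [MeasurableSpace S]
    (μ : Measure (V → S)) : Prop :=
  ∃ n : ℕ → ℕ, (∀ i, (regularGraphs d (n i)).Nonempty) ∧
    ∀ᵐ G ∂(Measure.infinitePi fun i => uniformOn (regularGraphs d (n i))), μ ∈ profile T S G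

/-! ### Rigid processes -/

/-- The star with root `o` (the root and all its neighbors) without the leaf `w`. -/
def starMinusLeaf {V : Type*} (T : SimpleGraph V) (o w : V) : Set V :=
  insert o (T.neighborSet o) \ {w}

/-- `μ` is rigid: for a star `C` with root `o` and a leaf `w` of it, almost surely the values on
`C \ {w}` determine the value on `w`, and the values on `C \ {w}` are not i.i.d.
For an invariant process on a regular tree the choice of the star and of the leaf is immaterial. -/
def IsRigid {V : Type*} (T : SimpleGraph V) {S : Type*} [MeasurableSpace S]
    (μ : Measure (V → S)) : Prop :=
  ∃ o w : V, T.Adj o w ∧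
    (∃ F : (starMinusLeaf T o w → S) → S,
      ∀ᵐ f ∂μ, f w = F (fun v : starMinusLeaf T o w => f v)) ∧
    ¬ (iIndepFun (fun (v : starMinusLeaf T o w) (f : V → S) => f v) μ ∧
        ∀ u v : starMinusLeaf T o w,
          IdentDistrib (fun f : V → S => f u) (fun f : V → S => f v) μ μ)

/-! The heart is an entropy inequality: for a typical process, H(star) is at least (d/2) H(edge). It
is a first moment argument. Record for each vertex of a colored `d`-regular graph on `n` vertices
its color and its number of neighbors of each color. By the configuration model heuristic, the
expected number of colorings of a random regular graph whose statistics are close to those of the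
process is exp(n (H(star) - (d/2) H(edge))) up to subexponential factors. If the exponent is
negative, large random graphs have such a coloring with probability at most 1/2, and by independence
this cannot happen for all large indices.

The count is carried out on simple graphs. `card_graphsWithColorDegrees_mul_le` bounds from above
the number of graphs with prescribed color degrees, by deleting one edge at a time.
`sqrt_factorial_le_card_regular` bounds the number of all regular graphs from below up to a
polynomial factor, by adding weighted edges to the empty graph and repairing the last few by
switchings. Factorial estimates turn the ratio into entropies in `card_graphs_of_growthRate_le`, and
`IsTypical.edge_entropy_le_star_entropy` is the resulting inequality.

If one leaf is determined by the rest of the star, then H(star) = H(star minus leaf), which is at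
most H(v) + (d-1)(H(e) - H(v)) because leaves are at best conditionally independent given the
center. Combined with the entropy inequality and d > 2 this gives H(e) ≥ 2 H(v), so H(star minus
leaf) ≥ d H(v). Equality in Gibbs' inequality makes the d labels independent
(`eq_prod_of_entropy_ge`), and invariance makes them identically distributed, against rigidity.

An eigenvector equation also determines a leaf, so the other labels of the star are i.i.d. With the
center fixed and the other d-1 leaves all minimal or all maximal in the support, the determined
values differ by d-1 times the diameter of the support. Both lie in the support, so the diameter is
0. -/

/-! ### Automorphisms and balls of regular trees -/

namespace SimpleGraph

variable {V : Type*}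

/-- The parent of `v` with respect to the root `o` is unique: a geodesic from `o` to a closer
neighbor is too short to pass through `v`, so that neighbor is the last vertex before `v` on the
path from `o` to `v`. -/
lemma IsTree.eq_of_dist_succ {T : SimpleGraph V} (hT : T.IsTree) {o v p q : V}
    (hp : T.Adj v p) (hq : T.Adj v q) (hdp : T.dist o v = T.dist o p + 1)
    (hdq : T.dist o v = T.dist o q + 1) : p = q := by
  classical
  obtain ⟨R, hR, -⟩ := (hT.connected o v).exists_path_of_dist
  have key : ∀ x, T.Adj v x → T.dist o v = T.dist o x + 1 → x = R.penultimate := by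
    intro x hx hd
    obtain ⟨P, hP, hlen⟩ := (hT.connected o x).exists_path_of_dist
    have hv : v ∉ P.support := by
      intro hv
      have h1 := T.dist_le (P.takeUntil v hv)
      have h2 := P.length_takeUntil_le_length hv
      omega
    exact hT.isAcyclic.eq_penultimate_of_adj_end hR hx
      (hT.isAcyclic.mem_support_of_ne_mem_support_of_adj_of_isPath hR hP hx hv)
  rw [key p hp hdp, key q hq hdq]

lemma Connected.exists_adj_dist_succ {T : SimpleGraph V} (hT : T.Connected) {o v : V} (hv : v ≠ o) :
    ∃ p, T.Adj v p ∧ T.dist o v = T.dist o p + 1 := by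
  obtain ⟨P, hlen⟩ := (hT v o).exists_walk_length_eq_dist
  cases P with
  | nil => exact absurd rfl hv
  | @cons _ w _ h P =>
    refine ⟨w, h, ?_⟩
    rw [Walk.length_cons] at hlen
    have h1 := T.dist_le P
    have h2 := h.diff_dist_adj (u := o)
    have h3 := T.dist_comm (u := o) (v := v)
    have h4 := T.dist_comm (u := o) (v := w)
    omega

/-- A self-map of a tree that is bijective between neighborhoods is an automorphism. -/
lemma IsTree.exists_iso_of_bijOn {T : SimpleGraph V} (hT : T.IsTree) (φ : V → V)
    (h : ∀ v, Set.BijOn φ (T.neighborSet v) (T.neighborSet (φ v))) :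
    ∃ Φ : T ≃g T, ∀ v, Φ v = φ v := by
  classical
  let F : T →g T := ⟨φ, fun {a b} hab => (h a).mapsTo hab⟩
  have hF : ∀ v, F v = φ v := fun v => rfl
  have inj : Function.Injective φ := by
    intro u v huv
    obtain ⟨P, hP⟩ := (hT.existsUnique_path u v).exists
    have hch := (hT.isAcyclic.isPath_iff_isChain P).1 hP
    -- Local injectivity keeps the image of a non-backtracking walk non-backtracking. In a forest
    -- such a walk is a path, and a path with equal endpoints is trivial.
    have key : ∀ {a b : V} (P : T.Walk a b), P.edges.IsChain (· ≠ ·) →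
        (P.map F).edges.IsChain (· ≠ ·) := by
      intro a b P
      induction P with
      | nil => simp
      | @cons a b c hab Q ih =>
        cases Q with
        | nil => simp
        | @cons _ e _ hbe Q =>
          intro hc
          simp only [Walk.edges_cons, Walk.map_cons, List.isChain_cons_cons] at hc ih ⊢
          refine ⟨?_, ih hc.2⟩
          intro hne
          apply hc.1
          have : F a = F e := by
            have h1 : F b ≠ F e := (F.map_adj hbe).ne
            rw [Sym2.eq_iff] at hne
            rcases hne with ⟨h2, h3⟩ | ⟨h2, -⟩
            · exact absurd h3 h1
            · exact h2
          rw [(h b).injOn hab.symm hbe this]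
          exact Sym2.eq_swap
    have h2 : (P.map F).IsPath := (hT.isAcyclic.isPath_iff_isChain _).2 (key P hch)
    have huv' : F u = F v := huv
    have h3 : ((P.map F).copy rfl huv'.symm).IsPath := (Walk.isPath_copy _ _ _).2 h2
    rw [Walk.isPath_iff_nil, ← Walk.length_eq_zero_iff, Walk.length_copy, Walk.length_map] at h3
    exact Walk.eq_of_length_eq_zero h3
  have surj : Function.Surjective φ := by
    obtain ⟨o⟩ := hT.connected.nonempty
    have key : ∀ {a b : V} (P : T.Walk a b), a ∈ Set.range φ → b ∈ Set.range φ := by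
      intro a b P
      induction P with
      | nil => exact id
      | cons hab Q ih =>
        rintro ⟨x, rfl⟩
        obtain ⟨y, -, hy⟩ := (h x).surjOn hab
        exact ih ⟨y, hy⟩
    intro y
    exact key (hT.connected (φ o) y).some ⟨o, rfl⟩
  refine ⟨⟨Equiv.ofBijective φ ⟨inj, surj⟩, ?_⟩, fun v => rfl⟩
  intro a b
  constructor
  · intro hab
    obtain ⟨y, hy, hyb⟩ := (h a).surjOn (show φ b ∈ T.neighborSet (φ a) from hab)
    rw [← inj hyb]
    exact hy
  · intro hab
    exact (h a).mapsTo hab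

/-- In a regular tree every bijection between two neighborhoods extends to an automorphism. -/
lemma IsTree.exists_iso_extending {T : SimpleGraph V} [T.LocallyFinite] (hT : T.IsTree) {d : ℕ}
    (hreg : T.IsRegularOfDegree d) {o o' : V} (β : T.neighborSet o ≃ T.neighborSet o') :
    ∃ Φ : T ≃g T, Φ o = o' ∧ ∀ w : T.neighborSet o, Φ w = β w := by
  classical
  -- A bijection of neighborhoods that respects parents: any bijection is corrected by a swap so
  -- that `p` goes to `p'`. Outside the relevant case `id` is a dummy value.
  have hE : ∀ v v' p p' : V, ∃ e : V → V, T.Adj v p → T.Adj v' p' →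
      Set.BijOn e (T.neighborSet v) (T.neighborSet v') ∧ e p = p' := by
    intro v v' p p'
    by_cases hp : T.Adj v p
    · by_cases hp' : T.Adj v' p'
      · have hc : Fintype.card (T.neighborSet v) = Fintype.card (T.neighborSet v') := by
          rw [card_neighborSet_eq_degree, card_neighborSet_eq_degree, hreg v, hreg v']
        let e₀ := Fintype.equivOfCardEq hc
        let e₁ := e₀.trans (Equiv.swap (e₀ ⟨p, hp⟩) ⟨p', hp'⟩)
        refine ⟨fun x => if hx : x ∈ T.neighborSet v then e₁ ⟨x, hx⟩ else x,
          fun _ _ => ⟨⟨?_, ?_, ?_⟩, ?_⟩⟩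
        · intro x hx
          simp only [dif_pos hx]
          exact (e₁ ⟨x, hx⟩).2
        · intro x hx y hy hxy
          simp only [dif_pos hx, dif_pos hy] at hxy
          exact congrArg Subtype.val (e₁.injective (Subtype.ext hxy))
        · intro y hy
          have hx : ↑(e₁.symm ⟨y, hy⟩) ∈ T.neighborSet v := (e₁.symm ⟨y, hy⟩).2
          refine ⟨e₁.symm ⟨y, hy⟩, hx, ?_⟩
          simp only [dif_pos hx]
          simp
        · have hp : p ∈ T.neighborSet v := hp
          simp [hp, e₁]
      · exact ⟨id, fun _ h => absurd h hp'⟩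
    · exact ⟨id, fun h => absurd h hp⟩
  choose E hE using hE
  have hpar : ∀ v, ∃ p, v ≠ o → T.Adj v p ∧ T.dist o v = T.dist o p + 1 := by
    intro v
    by_cases hv : v = o
    · exact ⟨v, fun h => absurd hv h⟩
    · obtain ⟨p, hp⟩ := hT.connected.exists_adj_dist_succ hv
      exact ⟨p, fun _ => hp⟩
  choose par hpar using hpar
  let B : V → V := fun x => if hx : x ∈ T.neighborSet o then β ⟨x, hx⟩ else x
  -- The image of `v` depends on the images of its parent and grandparent, since the bijection
  -- around the parent must send the grandparent where it has already gone. Hence the two-step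
  -- recursion on the distance from `o`.
  let F : ℕ → V → V := fun k => Nat.twoStepInduction (motive := fun _ => V → V)
    (fun _ => o') B
    (fun _ f0 f1 v => E (par v) (f1 (par v)) (par (par v)) (f0 (par (par v))) v) k
  let φ : V → V := fun v => F (T.dist o v) v
  have hφo : φ o = o' := by simp [φ, F, Nat.twoStepInduction]
  have hdist : ∀ v, T.dist o v = 0 ↔ v = o := by
    intro v
    rw [hT.connected.dist_eq_zero_iff]
    exact eq_comm
  have hφ1 : ∀ v, T.Adj o v → φ v = B v := by
    intro v hv
    have : T.dist o v = 1 := dist_eq_one_iff_adj.2 hv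
    simp [φ, F, this, Nat.twoStepInduction]
  have hφ2 : ∀ v, v ≠ o → par v ≠ o →
      φ v = E (par v) (φ (par v)) (par (par v)) (φ (par (par v))) v := by
    intro v hv hpv
    have h1 := (hpar v hv).2
    have h2 := (hpar _ hpv).2
    have h3 : T.dist o v = T.dist o (par (par v)) + 2 := by omega
    simp only [φ, F, h3, h2, Nat.twoStepInduction]
  have hBbij : Set.BijOn B (T.neighborSet o) (T.neighborSet o') := by
    refine ⟨?_, ?_, ?_⟩
    · intro x hx
      simp only [B, dif_pos hx]
      exact (β ⟨x, hx⟩).2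
    · intro x hx y hy hxy
      simp only [B, dif_pos hx, dif_pos hy] at hxy
      exact congrArg Subtype.val (β.injective (Subtype.ext hxy))
    · intro y hy
      have hx : ↑(β.symm ⟨y, hy⟩) ∈ T.neighborSet o := (β.symm ⟨y, hy⟩).2
      refine ⟨β.symm ⟨y, hy⟩, hx, ?_⟩
      simp only [B, dif_pos hx]
      simp
  have hbij_o : Set.BijOn φ (T.neighborSet o) (T.neighborSet (φ o)) := by
    rw [hφo]
    exact hBbij.congr fun x hx => (hφ1 x hx).symm
  have hadj : ∀ k v, v ≠ o → T.dist o v = k → T.Adj (φ v) (φ (par v)) := by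
    intro k
    induction k with
    | zero => intro v hv hd; exact absurd ((hdist v).1 hd) hv
    | succ k ih =>
      intro v hv hd
      obtain ⟨h1, h2⟩ := hpar v hv
      by_cases hpo : par v = o
      · rw [hpo] at h1 ⊢
        exact (hbij_o.mapsTo h1.symm).symm
      · rw [hφ2 v hv hpo]
        exact ((hE _ _ _ _ (hpar _ hpo).1 (ih _ hpo (by omega))).1.mapsTo h1.symm).symm
  have hbij : ∀ v, Set.BijOn φ (T.neighborSet v) (T.neighborSet (φ v)) := by
    intro v
    by_cases hv : v = o
    · rw [hv]; exact hbij_o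
    · obtain ⟨h1, h2⟩ := hE _ _ _ _ (hpar v hv).1 (hadj _ v hv rfl)
      refine h1.congr fun x hx => ?_
      rcases hT.dist_eq_dist_add_one_of_adj o hx with hd | hd
      · rw [hT.eq_of_dist_succ hx (hpar v hv).1 hd (hpar v hv).2, h2]
      · have hxo : x ≠ o := by
          rintro rfl
          simp at hd
        have : par x = v := hT.eq_of_dist_succ (hpar x hxo).1 hx.symm (hpar x hxo).2 hd
        rw [hφ2 x hxo (by rwa [this]), this]
  obtain ⟨Φ, hΦ⟩ := hT.exists_iso_of_bijOn φ hbij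
  refine ⟨Φ, by rw [hΦ, hφo], fun w => ?_⟩
  rw [hΦ, hφ1 w w.2]
  have : (w : V) ∈ T.neighborSet o := w.2
  exact dif_pos this

/-- An infinite-type growth property: spheres of every radius are nonempty. -/
lemma IsTree.exists_dist_eq {T : SimpleGraph V} [T.LocallyFinite] (hT : T.IsTree) {d : ℕ}
    (hd : 2 ≤ d) (hreg : T.IsRegularOfDegree d) (o : V) (r : ℕ) : ∃ v, T.dist o v = r := by
  classical
  induction r with
  | zero => exact ⟨o, by simp⟩
  | succ r ih =>
    obtain ⟨v, hv⟩ := ih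
    have hcard : 1 < (T.neighborFinset v).card := by
      rw [card_neighborFinset_eq_degree, hreg v]; omega
    obtain ⟨x, hx, y, hy, hxy⟩ := Finset.one_lt_card.1 hcard
    rw [mem_neighborFinset] at hx hy
    rcases hT.dist_eq_dist_add_one_of_adj o hx with h1 | h1
    · rcases hT.dist_eq_dist_add_one_of_adj o hy with h2 | h2
      · exact absurd (hT.eq_of_dist_succ hx hy h1 h2) hxy
      · exact ⟨y, by omega⟩
    · exact ⟨x, by omega⟩

lemma IsTree.finite_closedGraphBall {T : SimpleGraph V} [T.LocallyFinite] (o : V) (r : ℕ) :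
    (closedGraphBall T o r).Finite := by
  induction r with
  | zero =>
    refine (Set.finite_singleton o).subset fun w hw => ?_
    have hw : T.edist o w ≤ (0 : ℕ) := hw
    simpa using (edist_eq_zero_iff.1 (nonpos_iff_eq_zero.1 hw)).symm
  | succ r ih =>
    refine (ih.union (ih.biUnion fun v _ => (T.neighborSet v).toFinite)).subset fun w hw => ?_
    have hw : T.edist o w ≤ (r + 1 : ℕ) := hw
    obtain ⟨P, hP⟩ := exists_walk_of_edist_ne_top (ne_top_of_le_ne_top (ENat.natCast_ne_top _) hw)
    rw [← hP] at hw
    have hlen : P.length ≤ r + 1 := by exact_mod_cast hw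
    by_cases hnil : P.length ≤ r
    · left
      show T.edist o w ≤ r
      exact (T.edist_le P).trans (by exact_mod_cast hnil)
    · right
      have hPn : ¬ P.Nil := by
        intro h
        rw [← Walk.length_eq_zero_iff] at h
        omega
      refine Set.mem_biUnion (x := P.penultimate) ?_ (P.adj_penultimate hPn)
      refine (T.edist_le P.dropLast).trans ?_
      have : P.dropLast.length ≤ r := by simp; omega
      exact_mod_cast this

/-- Needed to pass from an almost sure statement at each vertex to one holding at all vertices
simultaneously. -/
lemma Connected.countable {T : SimpleGraph V} [T.LocallyFinite] (hT : T.Connected) :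
    Countable V := by
  obtain ⟨o⟩ := hT.nonempty
  rw [← Set.countable_univ_iff]
  refine (Set.countable_iUnion fun r : ℕ =>
    (IsTree.finite_closedGraphBall (T := T) o r).countable).mono fun v _ => ?_
  refine Set.mem_iUnion.2 ⟨T.dist o v, ?_⟩
  exact (hT o v).coe_dist_eq_edist.symm.le

/-- One vertex is taken on each sphere of radius at most `r`. A finite graph containing an
isomorphic copy of the ball must therefore have more than `r` vertices. -/
lemma IsTree.card_closedGraphBall {T : SimpleGraph V} [T.LocallyFinite] (hT : T.IsTree) {d : ℕ}
    (hd : 2 ≤ d) (hreg : T.IsRegularOfDegree d) (o : V) (r : ℕ) :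
    r < (closedGraphBall T o r).ncard := by
  choose g hg using hT.exists_dist_eq hd hreg o
  have hsub : g '' (Finset.range (r + 1) : Set ℕ) ⊆ closedGraphBall T o r := by
    rintro _ ⟨k, hk, rfl⟩
    show T.edist o (g k) ≤ r
    rw [← (hT.connected o (g k)).coe_dist_eq_edist, hg]
    have hk : k < r + 1 := by simpa using hk
    exact_mod_cast Nat.lt_succ_iff.1 hk
  have hinj : Function.Injective g := fun a b hab => by rw [← hg a, ← hg b, hab]
  have := Set.ncard_le_ncard hsub (IsTree.finite_closedGraphBall o r)
  rw [Set.ncard_image_of_injective _ hinj, Set.ncard_coe_finset, Finset.card_range] at this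
  exact this

end SimpleGraph

/-! ### Upper bound on graphs with prescribed color degrees -/

/-- The number of neighbors of `v` that have the color `b`. -/
noncomputable def colorDegree {V S : Type*} (G : SimpleGraph V) (f : V → S) (v : V) (b : S) : ℕ :=
  {w | G.Adj v w ∧ f w = b}.ncard

/-- The number of half-edges of type `p` prescribed by the color degrees `τ`. -/
noncomputable def typeCount {V S : Type*} [Fintype V] (f : V → S) (τ : V × S → ℕ) (p : S × S) : ℕ :=
  open Classical in ∑ v, if f v = p.1 then τ (v, p.2) else 0

section Counting

open scoped Classical Nat
open SimpleGraph

variable {V S : Type*} [Fintype V]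

lemma colorDegree_eq_sum (G : SimpleGraph V) (f : V → S) (v : V) (b : S) :
    colorDegree G f v b = ∑ w, if G.Adj v w ∧ f w = b then 1 else 0 := by
  rw [colorDegree, Set.ncard_eq_toFinset_card', Finset.sum_boole]
  simp

/-- The two increments are indicators of single points of `V × S`, the form in which products of
factorials over `V × S` can be updated. -/
lemma colorDegree_sup_edge {G : SimpleGraph V} (f : V → S) {u v : V} (huv : u ≠ v)
    (h : ¬ G.Adj u v) (x : V) (c : S) :
    colorDegree (G ⊔ edge u v) f x c = colorDegree G f x c +
      (if (x, c) = (u, f v) then 1 else 0) + (if (x, c) = (v, f u) then 1 else 0) := by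
  simp only [colorDegree_eq_sum, Prod.mk.injEq]
  have e1 : (if x = u ∧ c = f v then 1 else 0) =
      ∑ w, if w = v ∧ (x = u ∧ c = f w) then 1 else 0 := by
    rw [Finset.sum_eq_single v] <;> simp +contextual
  have e2 : (if x = v ∧ c = f u then 1 else 0) =
      ∑ w, if w = u ∧ (x = v ∧ c = f w) then 1 else 0 := by
    rw [Finset.sum_eq_single u] <;> simp +contextual
  rw [e1, e2, ← Finset.sum_add_distrib, ← Finset.sum_add_distrib]
  refine Finset.sum_congr rfl fun w _ => ?_
  have h' : ¬ G.Adj v u := fun h1 => h h1.symm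
  simp only [sup_adj, edge_adj]
  by_cases h1 : x = u
  · subst h1
    by_cases h2 : w = v
    · subst h2
      simp [h, huv, huv.symm, eq_comm]
    · simp [h2, huv, eq_comm]
  · by_cases h2 : x = v
    · subst h2
      by_cases h3 : w = u
      · subst h3
        simp [h', huv, huv.symm, eq_comm]
      · simp [h3, huv.symm, eq_comm]
    · simp [h1, h2]

/-- Both sides count the ordered adjacent pairs colored `(a, b)`, read in the two directions. -/
lemma typeCount_comm (G : SimpleGraph V) (f : V → S) (τ : V × S → ℕ)
    (h : ∀ v b, colorDegree G f v b = τ (v, b)) (a b : S) :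
    typeCount f τ (a, b) = typeCount f τ (b, a) := by
  have key : ∀ a b : S, typeCount f τ (a, b) =
      ∑ v, ∑ w, if G.Adj v w ∧ f v = a ∧ f w = b then 1 else 0 := by
    intro a b
    refine Finset.sum_congr rfl fun v _ => ?_
    simp only [← h, colorDegree_eq_sum]
    split_ifs with h1 <;> simp [h1]
  rw [key, key, Finset.sum_comm]
  refine Finset.sum_congr rfl fun v _ => Finset.sum_congr rfl fun w _ => ?_
  simp only [G.adj_comm v w, and_comm (a := f w = a)]

lemma prod_factorial_add_single {ι : Type*} [Fintype ι] [DecidableEq ι] (h : ι → ℕ) (i : ι) :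
    ∏ j, (h j + if j = i then 1 else 0)! = (∏ j, (h j)!) * (h i + 1) := by
  rw [← Finset.mul_prod_erase Finset.univ _ (Finset.mem_univ i),
    ← Finset.mul_prod_erase Finset.univ (fun j => (h j)!) (Finset.mem_univ i), if_pos rfl,
    Nat.factorial_succ]
  have : ∏ x ∈ Finset.univ.erase i, (h x + if x = i then 1 else 0)! =
      ∏ x ∈ Finset.univ.erase i, (h x)! :=
    Finset.prod_congr rfl fun x hx => by rw [if_neg (Finset.ne_of_mem_erase hx), add_zero]
  rw [this]
  ring

lemma typeCount_add_single (f : V → S) (τ : V × S → ℕ) (x : V × S) (p : S × S) :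
    typeCount f (fun y => τ y + if y = x then 1 else 0) p =
      typeCount f τ p + if p = (f x.1, x.2) then 1 else 0 := by
  have : (if p = (f x.1, x.2) then 1 else 0) =
      ∑ v, if v = x.1 ∧ f v = p.1 ∧ x.2 = p.2 then 1 else 0 := by
    rw [Finset.sum_eq_single x.1] <;> simp +contextual [Prod.ext_iff, eq_comm]
  rw [typeCount, typeCount, this, ← Finset.sum_add_distrib]
  refine Finset.sum_congr rfl fun v _ => ?_
  by_cases h1 : f v = p.1 <;> by_cases h2 : v = x.1 <;> by_cases h3 : x.2 = p.2 <;>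
    simp [h1, h2, h3, Prod.ext_iff, eq_comm] <;> simp_all [eq_comm]

/-- The graphs with prescribed numbers of neighbors of every color. -/
noncomputable def graphsWithColorDegrees (f : V → S) (τ : V × S → ℕ) : Finset (SimpleGraph V) :=
  {G | ∀ v b, colorDegree G f v b = τ (v, b)}

lemma mem_graphsWithColorDegrees {f : V → S} {τ : V × S → ℕ} {G : SimpleGraph V} :
    G ∈ graphsWithColorDegrees f τ ↔ ∀ v b, colorDegree G f v b = τ (v, b) := by
  simp [graphsWithColorDegrees]

variable [Fintype S]

/-- This exposes one half-edge from `u` towards color `b`. Each graph has `τ (u, b)` edges of this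
kind, and deleting `uv` is injective on the graphs containing it. Deletion divides the product of
factorials by `τ (u, b) * τ (v, f u)`; the first factor cancels the multiplicity and the second
remains as the number of half-edges at `v` that could be the partner. -/
lemma card_graphsWithColorDegrees_mul_le_sum (f : V → S) (τ : V × S → ℕ) (u : V) (b : S)
    (hub : 0 < τ (u, b)) :
    (graphsWithColorDegrees f τ).card * ∏ p, (τ p)! ≤
      ∑ v with f v = b ∧ v ≠ u ∧ 0 < τ (v, f u), τ (v, f u) *
        ((graphsWithColorDegrees f fun p => τ p - (if p = (u, b) then 1 else 0) -
            (if p = (v, f u) then 1 else 0)).card *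
          ∏ p, (τ p - (if p = (u, b) then 1 else 0) - (if p = (v, f u) then 1 else 0))!) := by
  set τ' : V → V × S → ℕ := fun v p => τ p - (if p = (u, b) then 1 else 0) -
            (if p = (v, f u) then 1 else 0) with hτ'
  set C : Finset V := {v | f v = b ∧ v ≠ u ∧ 0 < τ (v, f u)} with hC
  have hmemC : ∀ v, v ∈ C ↔ f v = b ∧ v ≠ u ∧ 0 < τ (v, f u) := by simp [hC]
  have hadd : ∀ v ∈ C, τ = fun p => (τ' v p + if p = (u, b) then 1 else 0) +
      if p = (v, f u) then 1 else 0 := by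
    intro v hv
    obtain ⟨-, h2, h3⟩ := (hmemC v).1 hv
    funext p
    simp only [hτ']
    by_cases hp1 : p = (u, b)
    · subst hp1
      have : ¬ (u, b) = (v, f u) := fun h => h2 (congrArg Prod.fst h).symm
      simp only [this, if_true, if_false]
      omega
    · by_cases hp2 : p = (v, f u)
      · subst hp2
        simp only [hp1, if_true, if_false]
        omega
      · simp [hp1, hp2]
  have hfact : ∀ v ∈ C, ∏ p, (τ p)! = (∏ p, (τ' v p)!) * (τ (u, b) * τ (v, f u)) := by
    intro v hv
    obtain ⟨-, h2, h3⟩ := (hmemC v).1 hv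
    have hne : ¬ (v, f u) = (u, b) := fun h => h2 (congrArg Prod.fst h)
    have hne' : ¬ (u, b) = (v, f u) := fun h => hne h.symm
    have e1 := congrFun (hadd v hv) (u, b)
    have e2 := congrFun (hadd v hv) (v, f u)
    simp only [hne, hne', if_true, if_false, add_zero] at e1 e2
    conv_lhs => rw [hadd v hv]
    beta_reduce
    rw [prod_factorial_add_single (fun p => τ' v p + if p = (u, b) then 1 else 0),
      prod_factorial_add_single (τ' v)]
    simp only [hne, if_false, add_zero]
    rw [← e1, ← e2]
    ring
  have hcount : τ (u, b) * (graphsWithColorDegrees f τ).card ≤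
      ∑ v ∈ C, (graphsWithColorDegrees f (τ' v)).card := by
    have h1 : τ (u, b) * (graphsWithColorDegrees f τ).card =
        ∑ v, ((graphsWithColorDegrees f τ).filter fun G => G.Adj u v ∧ f v = b).card := by
      simp only [Finset.card_filter]
      rw [Finset.sum_comm, Finset.sum_congr rfl (g := fun _ => τ (u, b)), Finset.sum_const,
        smul_eq_mul, mul_comm]
      intro G hG
      rw [← colorDegree_eq_sum]
      simp only [graphsWithColorDegrees, Finset.mem_filter, Finset.mem_univ, true_and] at hG
      exact hG u b
    rw [h1, ← Finset.sum_subset (Finset.subset_univ C)]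
    · refine Finset.sum_le_sum fun v hv => ?_
      obtain ⟨hvb, hvu, hv0⟩ := (hmemC v).1 hv
      refine Finset.card_le_card_of_injOn (fun G => G \ edge u v) ?_ ?_
      · intro G hG
        simp only [graphsWithColorDegrees, Finset.coe_filter, Finset.mem_filter, Finset.mem_univ,
          true_and, Set.mem_ofPred_eq] at hG ⊢
        obtain ⟨hG, hadj, -⟩ := hG
        intro x c
        have hsup : G \ edge u v ⊔ edge u v = G := by
          rw [sdiff_sup_cancel]
          rw [edge_le_iff]
          exact Or.inr hadj
        have hn : ¬ (G \ edge u v).Adj u v := by simp [edge_adj, hvu.symm]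
        have := colorDegree_sup_edge f hvu.symm hn x c
        rw [hsup, hG, hvb] at this
        have h2 := congrFun (hadd v hv) (x, c)
        beta_reduce at h2
        omega
      · intro G hG G' hG' h
        simp only [Finset.coe_filter, Set.mem_ofPred_eq] at hG hG'
        beta_reduce at h
        have hs : ∀ G : SimpleGraph V, G.Adj u v → G \ edge u v ⊔ edge u v = G := by
          intro G hadj
          rw [sdiff_sup_cancel]
          rw [edge_le_iff]
          exact Or.inr hadj
        rw [← hs G hG.2.1, ← hs G' hG'.2.1, h]
    · intro v _ hv
      rw [Finset.card_eq_zero, Finset.filter_eq_empty_iff]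
      rintro G hG ⟨hadj, hvb⟩
      apply hv
      rw [hmemC]
      refine ⟨hvb, hadj.ne', ?_⟩
      simp only [graphsWithColorDegrees, Finset.mem_filter, Finset.mem_univ, true_and] at hG
      rw [← hG v (f u), colorDegree, Set.ncard_pos]
      exact ⟨u, hadj.symm, rfl⟩
  refine Nat.le_of_mul_le_mul_left (?_ : τ (u, b) * _ ≤ τ (u, b) * _) hub
  calc τ (u, b) * ((graphsWithColorDegrees f τ).card * ∏ p, (τ p)!)
      = (τ (u, b) * (graphsWithColorDegrees f τ).card) * ∏ p, (τ p)! := by ring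
    _ ≤ (∑ v ∈ C, (graphsWithColorDegrees f (τ' v)).card) * ∏ p, (τ p)! :=
        Nat.mul_le_mul_right _ hcount
    _ = τ (u, b) * ∑ v ∈ C, τ (v, f u) *
          ((graphsWithColorDegrees f (τ' v)).card * ∏ p, (τ' v p)!) := by
        rw [Finset.sum_mul, Finset.mul_sum]
        refine Finset.sum_congr rfl fun v hv => ?_
        rw [hfact v hv]
        ring

/-- The number of graphs with prescribed color degrees is at most what the configuration model
suggests. -/
theorem card_graphsWithColorDegrees_mul_le (f : V → S) (τ : V × S → ℕ) :
    ((graphsWithColorDegrees f τ).card * ∏ p, ((τ p)! : ℝ) : ℝ) ≤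
      √(∏ p, ((typeCount f τ p)! : ℝ)) := by
  induction hN : ∑ p, τ p using Nat.strong_induction_on generalizing τ with
  | _ N ih =>
  by_cases hne : (graphsWithColorDegrees f τ).Nonempty
  swap
  · rw [Finset.not_nonempty_iff_eq_empty.1 hne]
    simp
  -- The existence of such a graph is what makes `typeCount` symmetric, which the case `a ≠ b` below
  -- relies on.
  obtain ⟨G, hG⟩ := hne
  have hG' : ∀ v b, colorDegree G f v b = τ (v, b) := by
    simpa [graphsWithColorDegrees] using hG
  by_cases hzero : ∀ p, τ p = 0
  · have h1 : (graphsWithColorDegrees f τ).card ≤ 1 := by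
      have hbot : ∀ H ∈ graphsWithColorDegrees f τ, H = ⊥ := by
        intro H hH
        simp only [graphsWithColorDegrees, Finset.mem_filter, Finset.mem_univ, true_and] at hH
        rw [eq_bot_iff]
        intro x y hxy
        have := hH x (f y)
        rw [hzero, colorDegree, Set.ncard_eq_zero] at this
        exact (Set.eq_empty_iff_forall_notMem.1 this y ⟨hxy, rfl⟩).elim
      rw [Finset.card_le_one]
      intro A hA B hB
      rw [hbot A hA, hbot B hB]
    have h2 : ∀ p, typeCount f τ p = 0 := by
      intro p
      simp [typeCount, hzero]
    simp only [hzero, h2, Nat.factorial_zero, Nat.cast_one, Finset.prod_const_one, mul_one,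
      Real.sqrt_one]
    exact_mod_cast h1
  · push Not at hzero
    obtain ⟨⟨u, b⟩, hub⟩ := hzero
    have hub : 0 < τ (u, b) := Nat.pos_of_ne_zero hub
    have hstep := card_graphsWithColorDegrees_mul_le_sum f τ u b hub
    set τ' : V → V × S → ℕ := fun v p => τ p - (if p = (u, b) then 1 else 0) -
            (if p = (v, f u) then 1 else 0) with hτ'
    set C : Finset V := {v | f v = b ∧ v ≠ u ∧ 0 < τ (v, f u)} with hC
    have hmemC : ∀ v, v ∈ C ↔ f v = b ∧ v ≠ u ∧ 0 < τ (v, f u) := by simp [hC]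
    set a := f u with ha
    set M := typeCount f τ with hM
    -- `K` is the factor lost by the product of the factorials of `M` when one edge between colors
    -- `a` and `b` is deleted. If `a = b`, two half-edges leave the same class; otherwise `M (a, b)
    -- = M (b, a)` both drop by one.
    let K : ℝ := if a = b then M (a, a) * (M (a, a) - 1) else M (b, a) * M (b, a)
    have hKC : (∑ v ∈ C, (τ (v, a) : ℝ)) ≤ √K ∧ (a = b → 1 ≤ M (a, a)) := by
      have hsum : ∑ v ∈ C, τ (v, a) + (if a = b then τ (u, a) else 0) ≤ M (b, a) := by
        have huC : u ∉ C := fun h => ((hmemC u).1 h).2.1 rfl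
        have e : ∑ v ∈ C, τ (v, a) + (if a = b then τ (u, a) else 0) ≤
            ∑ v ∈ insert u C, if f v = b then τ (v, a) else 0 := by
          rw [Finset.sum_insert huC, add_comm, ← ha]
          refine Nat.add_le_add_left (Finset.sum_le_sum fun v hv => ?_) _
          rw [if_pos ((hmemC v).1 hv).1]
        exact e.trans (Finset.sum_le_univ_sum_of_nonneg fun _ => Nat.zero_le _)
      by_cases hab : a = b
      -- When the colors agree, `u` occupies a half-edge of the class itself, so at most `M (a, a) -
      -- 1` partners remain, and (M-1)² ≤ M (M-1).
      · have hpos : 1 ≤ τ (u, a) := by rw [hab]; exact hub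
        simp only [hab, if_true, K] at hsum hpos ⊢
        have h1 : ((∑ v ∈ C, τ (v, b) : ℕ) : ℝ) + 1 ≤ M (b, b) := by
          exact_mod_cast (by omega : ∑ v ∈ C, τ (v, b) + 1 ≤ M (b, b))
        refine ⟨?_, fun _ => by omega⟩
        apply Real.le_sqrt_of_sq_le
        push_cast at h1 ⊢
        have h0 : 0 ≤ ∑ v ∈ C, (τ (v, b) : ℝ) := Finset.sum_nonneg fun _ _ => Nat.cast_nonneg _
        nlinarith
      · simp only [hab, if_false, K, add_zero] at hsum ⊢
        rw [Real.sqrt_mul_self (Nat.cast_nonneg _)]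
        exact ⟨by exact_mod_cast hsum, fun h => h.elim⟩
    have hMeq : ∀ v ∈ C, (∏ p, ((M p)! : ℝ)) = (∏ p, ((typeCount f (τ' v) p)! : ℝ)) * K := by
      intro v hv
      obtain ⟨h1, h2, h3⟩ := (hmemC v).1 hv
      have hadd : τ = fun p => (τ' v p + if p = (u, b) then 1 else 0) +
          if p = (v, a) then 1 else 0 := by
        funext p
        simp only [hτ']
        by_cases hp1 : p = (u, b)
        · subst hp1
          have : ¬ (u, b) = (v, a) := fun h => h2 (congrArg Prod.fst h).symm
          simp only [this, if_true, if_false]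
          omega
        · by_cases hp2 : p = (v, a)
          · subst hp2
            simp only [hp1, if_true, if_false]
            omega
          · simp [hp1, hp2]
      have hMM : M = fun p => (typeCount f (τ' v) p + if p = (a, b) then 1 else 0) +
          if p = (b, a) then 1 else 0 := by
        funext p
        rw [hM, hadd, typeCount_add_single f (fun p => τ' v p + if p = (u, b) then 1 else 0),
          typeCount_add_single f (τ' v), h1]
      have hprod : ∏ p, (M p)! = (∏ p, (typeCount f (τ' v) p)!) *
          ((typeCount f (τ' v) (a, b) + 1) *
            (typeCount f (τ' v) (b, a) + (if (b, a) = (a, b) then 1 else 0) + 1)) := by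
        rw [hMM]
        beta_reduce
        rw [prod_factorial_add_single
            (fun p => typeCount f (τ' v) p + if p = (a, b) then 1 else 0),
          prod_factorial_add_single (typeCount f (τ' v))]
        ring
      have hK : (((typeCount f (τ' v) (a, b) + 1) *
            (typeCount f (τ' v) (b, a) + (if (b, a) = (a, b) then 1 else 0) + 1) : ℕ) : ℝ) = K := by
        by_cases hab : a = b
        · have e := congrFun hMM (a, a)
          simp only [hab, if_true] at e
          simp only [K, hab, if_true, e]
          push_cast
          ring
        · have hn1 : ¬ (b, a) = (a, b) := fun h => hab (congrArg Prod.snd h)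
          have hn2 : ¬ (a, b) = (b, a) := fun h => hn1 h.symm
          have e1 := congrFun hMM (a, b)
          have e2 := congrFun hMM (b, a)
          simp only [hn1, hn2, if_true, if_false, add_zero] at e1 e2
          simp only [K, hab, hn1, if_false, add_zero]
          rw [← e1, ← e2, hM, typeCount_comm G f τ hG' a b]
          push_cast
          ring
      rw [← hK]
      exact_mod_cast hprod
    have hlt : ∀ v ∈ C, ∑ p, τ' v p < N := by
      intro v _
      rw [← hN]
      refine Finset.sum_lt_sum (fun p _ => ?_) ⟨(u, b), Finset.mem_univ _, ?_⟩
      · simp only [hτ']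
        omega
      · simp only [hτ', if_true]
        omega
    calc ((graphsWithColorDegrees f τ).card * ∏ p, ((τ p)! : ℝ) : ℝ)
        ≤ ∑ v ∈ C, (τ (v, a) : ℝ) *
          ((graphsWithColorDegrees f (τ' v)).card * ∏ p, ((τ' v p)! : ℝ)) := by
          exact_mod_cast hstep
      _ ≤ ∑ v ∈ C, (τ (v, a) : ℝ) * √(∏ p, ((typeCount f (τ' v) p)! : ℝ)) := by
          gcongr with v hv
          exact ih _ (hlt v hv) (τ' v) rfl
      _ ≤ √(∏ p, ((M p)! : ℝ)) := by
          by_cases hCe : C.Nonempty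
          swap
          · rw [Finset.not_nonempty_iff_eq_empty.1 hCe, Finset.sum_empty]
            positivity
          obtain ⟨v₀, hv₀⟩ := hCe
          have hKpos : 0 < K := by
            have h1 := hMeq v₀ hv₀
            by_contra hK
            push Not at hK
            have h2 : (0 : ℝ) < ∏ p, ((M p)! : ℝ) :=
              Finset.prod_pos fun _ _ => by exact_mod_cast Nat.factorial_pos _
            have h3 : (0 : ℝ) < ∏ p, ((typeCount f (τ' v₀) p)! : ℝ) :=
              Finset.prod_pos fun _ _ => by exact_mod_cast Nat.factorial_pos _
            nlinarith
          have hc : ∀ v ∈ C, √(∏ p, ((typeCount f (τ' v) p)! : ℝ)) =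
              √(∏ p, ((M p)! : ℝ)) / √K := by
            intro v hv
            rw [eq_div_iff (Real.sqrt_pos.2 hKpos).ne', ← Real.sqrt_mul (by positivity),
              hMeq v hv]
          rw [Finset.sum_congr rfl fun v hv => by rw [hc v hv], ← Finset.sum_mul]
          calc (∑ v ∈ C, (τ (v, a) : ℝ)) * (√(∏ p, ((M p)! : ℝ)) / √K)
              ≤ √K * (√(∏ p, ((M p)! : ℝ)) / √K) := by
                gcongr
                exact hKC.1
            _ = √(∏ p, ((M p)! : ℝ)) := by
                rw [mul_div_cancel₀ _ (Real.sqrt_pos.2 hKpos).ne']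

end Counting

/-! ### Lower bound on the number of regular graphs -/

/-- The degree of a vertex, without finiteness assumptions. -/
noncomputable def vertexDegree {V : Type*} (G : SimpleGraph V) (v : V) : ℕ :=
  (G.neighborSet v).ncard

section DegreeDeficit

open scoped Classical Nat
open SimpleGraph

variable {V : Type*}

lemma sdiff_edge_sup_edge {G : SimpleGraph V} {u v : V} (h : G.Adj u v) :
    G \ edge u v ⊔ edge u v = G := by
  rw [sdiff_sup_cancel]
  rw [edge_le_iff]
  exact Or.inr h

lemma sup_edge_sdiff_edge {G : SimpleGraph V} {u v : V} (h : ¬ G.Adj u v) :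
    (G ⊔ edge u v) \ edge u v = G := by
  rw [sup_sdiff_right_self]
  exact sdiff_edge G h

lemma vertexDegree_eq_colorDegree (G : SimpleGraph V) (v : V) :
    vertexDegree G v = colorDegree G (fun _ => ()) v () := by
  simp [vertexDegree, colorDegree, neighborSet]

variable [Fintype V]

lemma vertexDegree_eq_sum (G : SimpleGraph V) (v : V) :
    vertexDegree G v = ∑ w, if G.Adj v w then 1 else 0 := by
  simp [vertexDegree_eq_colorDegree, colorDegree_eq_sum]

lemma vertexDegree_sup_edge {G : SimpleGraph V} {u v : V} (huv : u ≠ v) (h : ¬ G.Adj u v) (x : V) :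
    vertexDegree (G ⊔ edge u v) x =
      vertexDegree G x + (if x = u then 1 else 0) + (if x = v then 1 else 0) := by
  simpa [vertexDegree_eq_colorDegree] using colorDegree_sup_edge (fun _ => ()) huv h x ()

variable (V) in
/-- The graphs of maximal degree at most `d` that are `k` edges short of being `d`-regular. -/
noncomputable def deficientGraphs (d k : ℕ) : Finset (SimpleGraph V) :=
  {G | (∀ v, vertexDegree G v ≤ d) ∧ ∑ v, vertexDegree G v + 2 * k = Fintype.card V * d}

lemma mem_deficientGraphs {d k : ℕ} {G : SimpleGraph V} : G ∈ deficientGraphs V d k ↔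
    (∀ v, vertexDegree G v ≤ d) ∧ ∑ v, vertexDegree G v + 2 * k = Fintype.card V * d := by
  simp [deficientGraphs]

/-- The deficits add up to `2 * (k + 1)`, hence at least two: either one vertex lacks two edges, and
then `u = v`, or two different vertices lack one each. -/
lemma exists_deficient_pair {d k : ℕ} {G : SimpleGraph V} (hG : G ∈ deficientGraphs V d (k + 1)) :
    ∃ u v, ∀ w, vertexDegree G w + (if w = u then 1 else 0) + (if w = v then 1 else 0) ≤ d := by
  rw [mem_deficientGraphs] at hG
  obtain ⟨hle, hsum⟩ := hG
  by_cases h2 : ∃ u, vertexDegree G u + 2 ≤ d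
  · obtain ⟨u, hu⟩ := h2
    refine ⟨u, u, fun w => ?_⟩
    split_ifs with h
    · subst h; omega
    · exact hle w
  push Not at h2
  by_contra hno
  push Not at hno
  have hc : Fintype.card V * d = ∑ _v : V, d := by simp
  have h1 : ∃ u, vertexDegree G u < d := by
    by_contra hall
    push Not at hall
    have := Finset.sum_le_sum fun v (_ : v ∈ Finset.univ) => hall v
    omega
  obtain ⟨u, hu⟩ := h1
  have h3 : ∀ v, v ≠ u → vertexDegree G v = d := by
    intro v hv
    by_contra hvd
    obtain ⟨w, hw⟩ := hno u v
    have := hle w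
    have := hle v
    by_cases hwu : w = u
    · subst hwu
      simp only [if_true, if_neg hv.symm] at hw
      omega
    · by_cases hwv : w = v
      · subst hwv
        simp only [if_true, if_neg hv] at hw
        omega
      · simp only [if_neg hwu, if_neg hwv] at hw
        omega
  have h4 : ∑ v, vertexDegree G v + ∑ v, (if v = u then 1 else 0) = ∑ _v : V, d := by
    rw [← Finset.sum_add_distrib]
    refine Finset.sum_congr rfl fun v _ => ?_
    by_cases hv : v = u
    · subst hv
      have := h2 v
      simp only [if_true]
      omega
    · simp [hv, h3 v hv]
  simp only [Finset.sum_ite_eq', Finset.mem_univ, if_true] at h4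
  omega

lemma card_biUnion_insert_neighbors_le {d : ℕ} {G : SimpleGraph V}
    (hG : ∀ v, vertexDegree G v ≤ d) (B : Finset V) :
    (B.biUnion fun b => insert b (Finset.univ.filter fun w => G.Adj b w)).card ≤
      B.card * (d + 1) := by
  refine Finset.card_biUnion_le_card_mul _ _ _ fun b _ => ?_
  refine (Finset.card_insert_le _ _).trans ?_
  have h := hG b
  rw [vertexDegree_eq_sum, Finset.sum_boole] at h
  exact Nat.add_le_add_right (by exact_mod_cast h) 1

/-- At most 2(d+1)² vertices are within distance two of `u` or `v`, and at most `2 * k + 2` are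
isolated because each of those has positive deficit. Any other vertex `x` has a neighbor, and the
edge so obtained keeps away from `u`, `v` and their neighbors. -/
lemma exists_far_edge {d k : ℕ} {G : SimpleGraph V} (hd : 0 < d)
    (hG : G ∈ deficientGraphs V d (k + 1))
    (hn : 2 * (d + 1) * (d + 1) + (2 * k + 2) < Fintype.card V) (u v : V) :
    ∃ x y, G.Adj x y ∧ x ≠ u ∧ x ≠ v ∧ y ≠ u ∧ y ≠ v ∧ ¬ G.Adj u x ∧ ¬ G.Adj v y := by
  rw [mem_deficientGraphs] at hG
  obtain ⟨hle, hsum⟩ := hG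
  set N : Finset V → Finset V := fun B =>
    B.biUnion fun b => insert b (Finset.univ.filter fun w => G.Adj b w) with hN
  set Z : Finset V := {w | vertexDegree G w = 0} with hZ
  have hmemN : ∀ B b, b ∈ B → b ∈ N B ∧ ∀ w, G.Adj b w → w ∈ N B := by
    intro B b hb
    simp only [hN, Finset.mem_biUnion, Finset.mem_insert, Finset.mem_filter, Finset.mem_univ,
      true_and]
    exact ⟨⟨b, hb, Or.inl rfl⟩, fun w hw => ⟨b, hb, Or.inr hw⟩⟩
  have hcardZ : Z.card ≤ 2 * k + 2 := by
    have h1 : ∑ w, vertexDegree G w + ∑ w, (if vertexDegree G w = 0 then 1 else 0) ≤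
        ∑ _w : V, d := by
      rw [← Finset.sum_add_distrib]
      refine Finset.sum_le_sum fun w _ => ?_
      have := hle w
      split_ifs with h <;> omega
    rw [Finset.sum_boole] at h1
    have h2 : Fintype.card V * d = ∑ _v : V, d := by simp
    have h3 : (Z.card : ℕ) = (Finset.card {w | vertexDegree G w = 0}) := rfl
    simp only [Nat.cast_id] at h1
    omega
  have hcard : (N (N {u, v}) ∪ Z).card < Fintype.card V := by
    refine (Finset.card_union_le _ _).trans_lt (lt_of_le_of_lt ?_ hn)
    refine Nat.add_le_add ?_ hcardZ
    refine (card_biUnion_insert_neighbors_le hle _).trans (Nat.mul_le_mul_right _ ?_)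
    refine (card_biUnion_insert_neighbors_le hle _).trans (Nat.mul_le_mul_right _ ?_)
    exact Finset.card_le_two
  obtain ⟨x, hx⟩ : ∃ x, x ∉ N (N {u, v}) ∪ Z := by
    by_contra hall
    push Not at hall
    rw [Finset.eq_univ_iff_forall.2 hall, Finset.card_univ] at hcard
    exact lt_irrefl _ hcard
  rw [Finset.mem_union, not_or] at hx
  obtain ⟨hxN, hxZ⟩ := hx
  have hpos : 0 < vertexDegree G x := by
    simpa [hZ, Nat.pos_iff_ne_zero] using hxZ
  rw [vertexDegree, Set.ncard_pos] at hpos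
  obtain ⟨y, hy⟩ := hpos
  have hy : G.Adj x y := hy
  have hxB : x ∉ N {u, v} := fun h => hxN (hmemN _ _ h).1
  have hyB : y ∉ N {u, v} := fun h => hxN ((hmemN _ _ h).2 _ hy.symm)
  have hu : u ∈ ({u, v} : Finset V) := by simp
  have hv : v ∈ ({u, v} : Finset V) := by simp
  refine ⟨x, y, hy, ?_, ?_, ?_, ?_, ?_, ?_⟩
  · rintro rfl; exact hxB (hmemN _ _ hu).1
  · rintro rfl; exact hxB (hmemN _ _ hv).1
  · rintro rfl; exact hyB (hmemN _ _ hu).1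
  · rintro rfl; exact hyB (hmemN _ _ hv).1
  · exact fun h => hxB ((hmemN _ _ hu).2 _ h)
  · exact fun h => hyB ((hmemN _ _ hv).2 _ h)

/-- A switching argument: an edge can be added at the price of moving one other edge. -/
lemma card_deficientGraphs_succ_le {d k : ℕ} (hd : 0 < d)
    (hn : 2 * (d + 1) * (d + 1) + (2 * k + 2) < Fintype.card V) :
    (deficientGraphs V d (k + 1)).card ≤ Fintype.card V ^ 4 * (deficientGraphs V d k).card := by
  -- The switching replaces `xy` by `ux` and `vy`. The new graph together with `(x, y, u, v)`
  -- recovers the old one, which accounts for the fourth power.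
  have key : ∀ H : SimpleGraph V, ∃ (H' : SimpleGraph V) (q : V × V × V × V),
      H ∈ deficientGraphs V d (k + 1) → H' ∈ deficientGraphs V d k ∧
        H = (H' \ edge q.2.2.2 q.2.1) \ edge q.2.2.1 q.1 ⊔ edge q.1 q.2.1 := by
    intro H
    by_cases hH : H ∈ deficientGraphs V d (k + 1)
    swap
    · exact ⟨H, Classical.choice (by
        have : Nonempty V := Fintype.card_pos_iff.1 (by omega)
        infer_instance), fun h => absurd h hH⟩
    obtain ⟨u, v, huv⟩ := exists_deficient_pair hH
    obtain ⟨x, y, hxy, hxu, hxv, hyu, hyv, hux, hvy⟩ := exists_far_edge hd hH hn u v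
    have h0 : ¬ (H \ edge x y).Adj x y := by simp [edge_adj, hxy.ne]
    have h1 : ¬ (H \ edge x y).Adj u x := fun h => hux h.1
    have h2 : ¬ (H \ edge x y ⊔ edge u x).Adj v y := by
      rw [sup_adj, edge_adj]
      rintro (h | ⟨(⟨-, h⟩ | ⟨-, h⟩), -⟩)
      · exact hvy h.1
      · exact hxy.ne h.symm
      · exact hyu h
    have hdeg : ∀ w, vertexDegree (H \ edge x y ⊔ edge u x ⊔ edge v y) w =
        vertexDegree H w + (if w = u then 1 else 0) + (if w = v then 1 else 0) := by
      intro w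
      have e := vertexDegree_sup_edge hxy.ne h0 w
      rw [sdiff_edge_sup_edge hxy] at e
      rw [vertexDegree_sup_edge hyv.symm h2, vertexDegree_sup_edge hxu.symm h1, e]
      ring
    refine ⟨H \ edge x y ⊔ edge u x ⊔ edge v y, (x, y, u, v), fun _ => ⟨?_, ?_⟩⟩
    · rw [mem_deficientGraphs] at hH ⊢
      refine ⟨fun w => by rw [hdeg]; exact huv w, ?_⟩
      simp only [hdeg, Finset.sum_add_distrib, Finset.sum_ite_eq', Finset.mem_univ, if_true]
      omega
    · simp only
      rw [sup_edge_sdiff_edge h2, sup_edge_sdiff_edge h1, sdiff_edge_sup_edge hxy]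
  choose F q hF using key
  have : (deficientGraphs V d (k + 1)).card ≤
      ((Finset.univ : Finset (V × V × V × V)) ×ˢ deficientGraphs V d k).card := by
    refine Finset.card_le_card_of_injOn (fun H => (q H, F H)) ?_ ?_
    · intro H hH
      simpa using (hF H hH).1
    · intro H hH H' hH' h
      rw [(hF H hH).2, (hF H' hH').2]
      have h1 := congrArg Prod.fst h
      have h2 := congrArg Prod.snd h
      simp only at h1 h2
      rw [h1, h2]
  refine this.trans (le_of_eq ?_)
  rw [Finset.card_product, Finset.card_univ]
  simp only [Fintype.card_prod]
  ring

lemma card_deficientGraphs_le {d : ℕ} (hd : 0 < d) (k : ℕ)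
    (hn : 2 * (d + 1) * (d + 1) + (2 * k + 2) < Fintype.card V) :
    (deficientGraphs V d k).card ≤ Fintype.card V ^ (4 * k) * (deficientGraphs V d 0).card := by
  induction k with
  | zero => simp
  | succ k ih =>
    calc _ ≤ Fintype.card V ^ 4 * (deficientGraphs V d k).card :=
          card_deficientGraphs_succ_le hd (by omega)
      _ ≤ Fintype.card V ^ 4 * (Fintype.card V ^ (4 * k) * (deficientGraphs V d 0).card) :=
          Nat.mul_le_mul_left _ (ih (by omega))
      _ = _ := by ring

/-- The configuration-model weight of a graph of maximal degree at most `d`. -/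
noncomputable def deficitWeight (d : ℕ) (G : SimpleGraph V) : ℝ :=
  ∏ v, (((d - vertexDegree G v)! : ℕ) : ℝ)⁻¹

variable (V) in
/-- The total configuration-model weight of the graphs with `k` missing edges. -/
noncomputable def totalWeight (d k : ℕ) : ℝ :=
  ∑ G ∈ deficientGraphs V d k, deficitWeight d G

lemma deficitWeight_pos (d : ℕ) (G : SimpleGraph V) : 0 < deficitWeight d G :=
  Finset.prod_pos fun _ _ => inv_pos.2 (by exact_mod_cast Nat.factorial_pos _)

lemma deficitWeight_le_one (d : ℕ) (G : SimpleGraph V) : deficitWeight d G ≤ 1 :=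
  Finset.prod_le_one (fun _ _ => by positivity) fun _ _ =>
    inv_le_one_of_one_le₀ (by exact_mod_cast Nat.factorial_pos _)

/-- The gained factor is the number of ways to pair a free half-edge at `a` with a free half-edge at
`b`; this is what the weight is designed for. -/
lemma deficitWeight_sup_edge {d : ℕ} {G : SimpleGraph V} {a b : V} (hab : a ≠ b)
    (h : ¬ G.Adj a b) (ha : vertexDegree G a < d) (hb : vertexDegree G b < d) :
    deficitWeight d (G ⊔ edge a b) =
      deficitWeight d G * ((d - vertexDegree G a : ℕ) * (d - vertexDegree G b : ℕ)) := by
  have e : (fun w => d - vertexDegree G w) = fun w =>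
      ((d - vertexDegree (G ⊔ edge a b) w) + if w = a then 1 else 0) +
        if w = b then 1 else 0 := by
    funext w
    rw [vertexDegree_sup_edge hab h]
    by_cases h1 : w = a
    · subst h1
      simp only [if_true, hab, if_false]
      omega
    · by_cases h2 : w = b
      · subst h2
        simp only [if_true, h1, if_false]
        omega
      · simp [h1, h2]
  have ea := congrFun e a
  have eb := congrFun e b
  simp only [if_true, hab, hab.symm, if_false, add_zero] at ea eb
  have hprod : ∏ w, (d - vertexDegree G w)! = (∏ w, (d - vertexDegree (G ⊔ edge a b) w)!) *
      ((d - vertexDegree G a) * (d - vertexDegree G b)) := by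
    have e' : ∏ w, (d - vertexDegree G w)! = ∏ w,
      (((d - vertexDegree (G ⊔ edge a b) w) + if w = a then 1 else 0) +
        if w = b then 1 else 0)! := Finset.prod_congr rfl fun w _ => by rw [← congrFun e w]
    rw [e', prod_factorial_add_single
        (fun w => (d - vertexDegree (G ⊔ edge a b) w) + if w = a then 1 else 0),
      prod_factorial_add_single (fun w => d - vertexDegree (G ⊔ edge a b) w)]
    simp only [hab.symm, if_false, add_zero]
    rw [← ea, ← eb]
    ring
  have hprod' : (∏ w, ((d - vertexDegree G w)! : ℝ)) =
      (∏ w, ((d - vertexDegree (G ⊔ edge a b) w)! : ℝ)) *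
      ((d - vertexDegree G a : ℕ) * (d - vertexDegree G b : ℕ)) := by exact_mod_cast hprod
  have ha' : ((d - vertexDegree G a : ℕ) : ℝ) ≠ 0 := by
    exact_mod_cast (Nat.sub_pos_of_lt ha).ne'
  have hb' : ((d - vertexDegree G b : ℕ) : ℝ) ≠ 0 := by
    exact_mod_cast (Nat.sub_pos_of_lt hb).ne'
  simp only [deficitWeight, Finset.prod_inv_distrib]
  rw [hprod', mul_inv, mul_assoc, inv_mul_cancel₀ (mul_ne_zero ha' hb'), mul_one]

/-- Over all ordered pairs the sum would be (2k)². For fixed `a`, the excluded `b` are `a` itself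
and at most `d` neighbors, each of deficit at most `d`, which costs at most d + d² times the deficit
of `a`. -/
lemma sum_deficit_mul_deficit_ge {d k : ℕ} {G : SimpleGraph V}
    (hG : G ∈ deficientGraphs V d k) :
    (2 * k : ℝ) * (2 * k - (d + d ^ 2)) ≤ ∑ a, ∑ b, if a ≠ b ∧ ¬ G.Adj a b then
      ((d - vertexDegree G a : ℕ) * (d - vertexDegree G b : ℕ) : ℝ) else 0 := by
  rw [mem_deficientGraphs] at hG
  obtain ⟨hle, hsum⟩ := hG
  set δ : V → ℝ := fun v => ((d - vertexDegree G v : ℕ) : ℝ) with hδ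
  have hδ0 : ∀ v, 0 ≤ δ v := fun v => Nat.cast_nonneg _
  have hδd : ∀ v, δ v ≤ d := fun v =>
    Nat.cast_le.2 (Nat.sub_le d (vertexDegree G v))
  have hD : ∑ v, δ v = 2 * k := by
    have h1 : ∑ v, (d - vertexDegree G v) + ∑ v, vertexDegree G v = Fintype.card V * d := by
      rw [← Finset.sum_add_distrib, Finset.sum_congr rfl fun v _ => Nat.sub_add_cancel (hle v)]
      simp
    have h2 : ∑ v, (d - vertexDegree G v) = 2 * k := by omega
    rw [hδ, ← Nat.cast_sum, h2]
    push_cast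
    ring
  have hrow : ∀ a, δ a * (2 * k - (d + d ^ 2)) ≤
      ∑ b, if a ≠ b ∧ ¬ G.Adj a b then δ a * δ b else 0 := by
    intro a
    have h1 : (∑ b, if a ≠ b ∧ ¬ G.Adj a b then δ a * δ b else 0) +
        ((∑ b, if a = b then δ a * d else 0) + ∑ b, if G.Adj a b then δ a * d else 0) ≥
        ∑ b, δ a * δ b := by
      rw [← Finset.sum_add_distrib, ← Finset.sum_add_distrib]
      refine Finset.sum_le_sum fun b _ => ?_
      have := mul_le_mul_of_nonneg_left (hδd b) (hδ0 a)
      have h0 : 0 ≤ δ a * d := mul_nonneg (hδ0 a) (Nat.cast_nonneg _)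
      by_cases h : a = b
      · subst h; simpa using this
      · by_cases h' : G.Adj a b <;> simp [h, h', this]
    have h2 : (∑ b, if G.Adj a b then δ a * d else 0) ≤ δ a * d ^ 2 := by
      have : (∑ b, if G.Adj a b then δ a * d else 0) = vertexDegree G a * (δ a * d) := by
        rw [vertexDegree_eq_sum, Nat.cast_sum, Finset.sum_mul]
        refine Finset.sum_congr rfl fun b _ => ?_
        split_ifs <;> simp
      rw [this]
      have hdeg : (vertexDegree G a : ℝ) ≤ d := by exact_mod_cast hle a
      have h0 : 0 ≤ δ a * d := mul_nonneg (hδ0 a) (Nat.cast_nonneg _)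
      nlinarith
    have h3 : (∑ b, if a = b then δ a * d else 0) = δ a * d := by simp
    rw [← Finset.mul_sum, hD] at h1
    rw [h3] at h1
    linarith
  calc (2 * k : ℝ) * (2 * k - (d + d ^ 2)) = ∑ a, δ a * (2 * k - (d + d ^ 2)) := by
        rw [← Finset.sum_mul, hD]
    _ ≤ _ := Finset.sum_le_sum fun a _ => hrow a

/-- Double counting of edge additions: a graph with `k` missing edges can arise only through one of
its `2 * (m - k)` directed edges, and the direction together with the result determines the graph
before the addition. -/
lemma totalWeight_succ_le {d k m : ℕ} (hm : Fintype.card V * d = 2 * m) :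
    totalWeight V d (k + 1) * ((2 * (k + 1 : ℕ)) * (2 * (k + 1 : ℕ) - (d + d ^ 2))) ≤
      totalWeight V d k * (2 * (m - k)) := by
  calc totalWeight V d (k + 1) * ((2 * (k + 1 : ℕ)) * (2 * (k + 1 : ℕ) - (d + d ^ 2)))
      ≤ ∑ H ∈ deficientGraphs V d (k + 1), deficitWeight d H * ∑ a, ∑ b,
          if a ≠ b ∧ ¬ H.Adj a b then
            ((d - vertexDegree H a : ℕ) * (d - vertexDegree H b : ℕ) : ℝ) else 0 := by
        rw [totalWeight, Finset.sum_mul]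
        refine Finset.sum_le_sum fun H hH => ?_
        exact mul_le_mul_of_nonneg_left (sum_deficit_mul_deficit_ge hH) (deficitWeight_pos d H).le
    _ = ∑ a, ∑ b, ∑ H ∈ deficientGraphs V d (k + 1) with
          a ≠ b ∧ ¬ H.Adj a b ∧ vertexDegree H a < d ∧ vertexDegree H b < d,
          deficitWeight d (H ⊔ edge a b) := by
        simp only [Finset.mul_sum]
        rw [Finset.sum_comm]
        refine Finset.sum_congr rfl fun a _ => ?_
        rw [Finset.sum_comm]
        refine Finset.sum_congr rfl fun b _ => ?_
        rw [Finset.sum_filter]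
        refine Finset.sum_congr rfl fun H hH => ?_
        by_cases h1 : a ≠ b ∧ ¬ H.Adj a b
        · by_cases h2 : vertexDegree H a < d ∧ vertexDegree H b < d
          · rw [if_pos h1, if_pos ⟨h1.1, h1.2, h2⟩, deficitWeight_sup_edge h1.1 h1.2 h2.1 h2.2]
          · rw [if_pos h1, if_neg fun h => h2 h.2.2]
            have : d - vertexDegree H a = 0 ∨ d - vertexDegree H b = 0 := by omega
            rcases this with h | h <;> simp [h]
        · rw [if_neg h1, if_neg fun h => h1 ⟨h.1, h.2.1⟩, mul_zero]
    _ ≤ ∑ a, ∑ b, ∑ G ∈ deficientGraphs V d k with G.Adj a b, deficitWeight d G := by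
        refine Finset.sum_le_sum fun a _ => Finset.sum_le_sum fun b _ => ?_
        rw [← Finset.sum_image (f := deficitWeight d) (g := fun H => H ⊔ edge a b)]
        · refine Finset.sum_le_sum_of_subset_of_nonneg ?_ fun G _ _ => (deficitWeight_pos d G).le
          intro G hG
          rw [Finset.mem_image] at hG
          obtain ⟨H, hH, rfl⟩ := hG
          rw [Finset.mem_filter] at hH ⊢
          obtain ⟨hH, hab, hadj, hda, hdb⟩ := hH
          rw [mem_deficientGraphs] at hH ⊢
          refine ⟨⟨fun w => ?_, ?_⟩, ?_⟩
          · rw [vertexDegree_sup_edge hab hadj]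
            have := hH.1 w
            by_cases h1 : w = a
            · subst h1
              simp only [if_true, hab, if_false]
              omega
            · by_cases h2 : w = b
              · subst h2
                simp only [if_true, h1, if_false]
                omega
              · simpa [h1, h2] using this
          · simp only [vertexDegree_sup_edge hab hadj, Finset.sum_add_distrib,
              Finset.sum_ite_eq', Finset.mem_univ, if_true]
            omega
          · simp [edge_adj, hab]
        · intro H hH H' hH' h
          simp only [Finset.coe_filter, Set.mem_ofPred_eq] at hH hH'
          beta_reduce at h
          rw [← sup_edge_sdiff_edge hH.2.2.1, ← sup_edge_sdiff_edge hH'.2.2.1, h]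
    _ = ∑ G ∈ deficientGraphs V d k, deficitWeight d G * (2 * (m - k)) := by
        simp only [Finset.sum_filter]
        rw [Finset.sum_congr rfl fun a _ => Finset.sum_comm, Finset.sum_comm]
        refine Finset.sum_congr rfl fun G hG => ?_
        rw [mem_deficientGraphs] at hG
        have h1 : (∑ v, (vertexDegree G v : ℝ)) = 2 * (m - k) := by
          have : ∑ v, vertexDegree G v + 2 * k = 2 * m := by omega
          have : ∑ v, (vertexDegree G v : ℝ) + 2 * k = 2 * m := by exact_mod_cast this
          linarith
        rw [← h1, Finset.mul_sum]
        refine Finset.sum_congr rfl fun v _ => ?_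
        rw [vertexDegree_eq_sum, Nat.cast_sum, Finset.mul_sum]
        refine Finset.sum_congr rfl fun w _ => ?_
        split_ifs <;> simp
    _ = _ := by rw [totalWeight, Finset.sum_mul]

/-- Starting from the empty graph, of weight (d!)^(-n), the previous recursion is iterated. Its
coefficient is proportional to (k+1)(k+1-K), positive only for k ≥ K; hence the process stops with
`K` edges missing. -/
lemma le_totalWeight {d m K : ℕ} (hm : Fintype.card V * d = 2 * m) (hK : d + d ^ 2 = 2 * K)
    (j : ℕ) (hj : j + K ≤ m) :
    (2 ^ j * m ! * (m - K)! : ℝ) ≤ totalWeight V d (m - j) *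
      ((d ! : ℝ) ^ Fintype.card V * j ! * (m - j)! * (m - j - K)!) := by
  induction j with
  | zero =>
    have hbot : (⊥ : SimpleGraph V) ∈ deficientGraphs V d m := by
      rw [mem_deficientGraphs]
      simp [vertexDegree, hm]
    have h1 : deficitWeight d (⊥ : SimpleGraph V) ≤ totalWeight V d m :=
      Finset.single_le_sum (fun G _ => (deficitWeight_pos d G).le) hbot
    have h2 : deficitWeight d (⊥ : SimpleGraph V) * (d ! : ℝ) ^ Fintype.card V = 1 := by
      have : (d ! : ℝ) ≠ 0 := by exact_mod_cast (Nat.factorial_pos d).ne'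
      simp [deficitWeight, vertexDegree, this]
    have h3 : (0 : ℝ) < (d ! : ℝ) ^ Fintype.card V :=
      pow_pos (by exact_mod_cast Nat.factorial_pos d) _
    have h4 : 1 ≤ totalWeight V d m * (d ! : ℝ) ^ Fintype.card V := by
      rw [← h2]
      exact mul_le_mul_of_nonneg_right h1 h3.le
    simp only [pow_zero, one_mul, tsub_zero, Nat.factorial_zero, Nat.cast_one, mul_one]
    have h5 : (0 : ℝ) ≤ m ! * (m - K)! := by positivity
    nlinarith
  | succ j ih =>
    have ih := ih (by omega)
    obtain ⟨k, hk⟩ : ∃ k, m = k + 1 + j := ⟨m - j - 1, by omega⟩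
    have e1 : m - j = k + 1 := by omega
    have e2 : m - (j + 1) = k := by omega
    obtain ⟨l, hl⟩ : ∃ l, k = l + K := ⟨k - K, by omega⟩
    have e3 : k + 1 - K = l + 1 := by omega
    have e4 : k - K = l := by omega
    rw [e1, e3] at ih
    rw [e2, e4]
    have hs := totalWeight_succ_le (V := V) (k := k) hm
    have hK' : (d + d ^ 2 : ℝ) = 2 * K := by exact_mod_cast hK
    have hfac : (0 : ℝ) < (d ! : ℝ) ^ Fintype.card V * j ! * k ! * l ! := by positivity
    have hm' : (m : ℝ) = k + 1 + j := by exact_mod_cast hk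
    have hl' : (k : ℝ) = l + K := by exact_mod_cast hl
    rw [hK'] at hs
    have hs' : totalWeight V d (k + 1) * (2 * (k + 1) * (l + 1)) ≤
        totalWeight V d k * (j + 1) := by
      push_cast at hs
      rw [hm'] at hs
      have : (2 * ((k : ℝ) + 1) * (2 * (k + 1) - 2 * K)) = 2 * (2 * (k + 1) * (l + 1)) := by
        rw [hl']; ring
      rw [this] at hs
      linarith
    calc (2 ^ (j + 1) * m ! * (m - K)! : ℝ) = 2 * (2 ^ j * m ! * (m - K)!) := by ring
      _ ≤ 2 * (totalWeight V d (k + 1) *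
          ((d ! : ℝ) ^ Fintype.card V * j ! * (k + 1)! * (l + 1)!)) := by linarith
      _ = totalWeight V d (k + 1) * (2 * (k + 1) * (l + 1)) *
          ((d ! : ℝ) ^ Fintype.card V * j ! * k ! * l !) := by
        rw [Nat.factorial_succ k, Nat.factorial_succ l]
        push_cast
        ring
      _ ≤ totalWeight V d k * (j + 1) * ((d ! : ℝ) ^ Fintype.card V * j ! * k ! * l !) :=
        mul_le_mul_of_nonneg_right hs' hfac.le
      _ = _ := by
        rw [Nat.factorial_succ j]
        push_cast
        ring

lemma factorial_two_mul_le (m : ℕ) : ((2 * m)! : ℝ) ≤ (2 ^ m * m !) ^ 2 := by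
  have h1 : (2 * m).choose m ≤ 2 ^ (2 * m) := Nat.choose_le_two_pow _ _
  have h2 := Nat.choose_mul_factorial_mul_factorial (show m ≤ 2 * m by omega)
  have h3 : 2 * m - m = m := by omega
  rw [h3] at h2
  have : (2 * m)! ≤ (2 ^ m * m !) ^ 2 := by
    rw [← h2]
    calc (2 * m).choose m * m ! * m ! ≤ 2 ^ (2 * m) * m ! * m ! := by gcongr
      _ = _ := by ring
  exact_mod_cast this

/-- Up to a polynomial factor there are at least as many `d`-regular graphs as the configuration
model suggests. -/
theorem sqrt_factorial_le_card_regular {d K : ℕ} (hd : 0 < d) (hK : d + d ^ 2 = 2 * K)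
    (hn : 2 * (d + 1) * (d + 1) + (2 * K + 2) < Fintype.card V)
    (heven : Even (Fintype.card V * d)) :
    √((Fintype.card V * d)! : ℝ) ≤ (deficientGraphs V d 0).card *
      ((d ! : ℝ) ^ Fintype.card V * (2 ^ K * K ! * (Fintype.card V : ℝ) ^ (4 * K))) := by
  obtain ⟨m, hm⟩ := heven
  have hm : Fintype.card V * d = 2 * m := by omega
  have hKm : K ≤ m := by nlinarith
  -- Weighted additions produce graphs with `K` edges missing; switchings then supply these at the
  -- polynomial price n^(4K).
  have h1 := le_totalWeight hm hK (m - K) (by omega)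
  have e1 : m - (m - K) = K := by omega
  rw [e1, Nat.sub_self] at h1
  have h2 : totalWeight V d K ≤ (deficientGraphs V d K).card := by
    rw [totalWeight]
    refine (Finset.sum_le_sum fun G _ => deficitWeight_le_one d G).trans ?_
    simp
  have h3 : ((deficientGraphs V d K).card : ℝ) ≤
      (Fintype.card V : ℝ) ^ (4 * K) * (deficientGraphs V d 0).card := by
    exact_mod_cast card_deficientGraphs_le hd K hn
  have h4 : √((Fintype.card V * d)! : ℝ) ≤ 2 ^ m * m ! := by
    rw [hm]
    exact (Real.sqrt_le_sqrt (factorial_two_mul_le m)).trans (Real.sqrt_sq (by positivity)).le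
  refine h4.trans ?_
  have h5 : (0 : ℝ) < (m - K)! := by exact_mod_cast Nat.factorial_pos _
  have h6 : (2 : ℝ) ^ (m - K) * m ! ≤
      totalWeight V d K * ((d ! : ℝ) ^ Fintype.card V * K !) := by
    refine le_of_mul_le_mul_right ?_ h5
    refine h1.trans (le_of_eq ?_)
    simp only [Nat.factorial_zero, Nat.cast_one]
    ring
  have e2 : (2 : ℝ) ^ m = 2 ^ K * 2 ^ (m - K) := by
    rw [← pow_add]
    congr 1
    omega
  calc (2 : ℝ) ^ m * m ! = 2 ^ K * (2 ^ (m - K) * m !) := by rw [e2]; ring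
    _ ≤ 2 ^ K * (totalWeight V d K * ((d ! : ℝ) ^ Fintype.card V * K !)) := by gcongr
    _ ≤ 2 ^ K * (((Fintype.card V : ℝ) ^ (4 * K) * (deficientGraphs V d 0).card) *
        ((d ! : ℝ) ^ Fintype.card V * K !)) := by
      gcongr
      exact h2.trans h3
    _ = _ := by ring

end DegreeDeficit

/-! ### Factorials and entropy -/

section Stirling

open scoped Nat

/-- A crude Stirling bound suffices, since a logarithmic error in the exponent is only a polynomial
factor. The constant 2 makes the induction close: M/(M+1) + 2/(M+2) ≥ 1. -/
lemma factorial_le_exp (M : ℕ) :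
    (M ! : ℝ) ≤ Real.exp (M * Real.log M - M + 2 * Real.log (M + 1) + 1) := by
  induction M with
  | zero => simp
  | succ M ih =>
    rw [Nat.factorial_succ]
    push_cast
    have hpos : (0 : ℝ) < M + 1 := by positivity
    calc ((M : ℝ) + 1) * M ! ≤ Real.exp (Real.log (M + 1)) *
          Real.exp (M * Real.log M - M + 2 * Real.log (M + 1) + 1) := by
          rw [Real.exp_log hpos]
          gcongr
      _ ≤ _ := by
        rw [← Real.exp_add, Real.exp_le_exp]
        have h1 : (M : ℝ) / (M + 1) ≤ M * (Real.log (M + 1) - Real.log M) := by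
          rcases Nat.eq_zero_or_pos M with rfl | hM
          · simp
          · have hM' : (0 : ℝ) < M := by exact_mod_cast hM
            have := Real.one_sub_inv_le_log_of_pos (div_pos hpos hM')
            rw [Real.log_div hpos.ne' hM'.ne', inv_div] at this
            have e : (M : ℝ) / (M + 1) = M * (1 - M / (M + 1)) := by
              field_simp
              ring
            rw [e]
            gcongr
        have h2 : 1 / ((M : ℝ) + 2) ≤ Real.log (M + 1 + 1) - Real.log (M + 1) := by
          have := Real.one_sub_inv_le_log_of_pos
            (div_pos (by positivity : (0 : ℝ) < M + 1 + 1) hpos)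
          rw [Real.log_div (by positivity) hpos.ne', inv_div] at this
          refine le_trans (le_of_eq ?_) this
          field_simp
          ring
        have h3 : 1 ≤ (M : ℝ) / (M + 1) + 2 * (1 / (M + 2)) := by
          rw [div_add' _ _ _ hpos.ne', le_div_iff₀ hpos, mul_one_div, div_mul_eq_mul_div,
            ← sub_le_iff_le_add', le_div_iff₀ (by positivity)]
          nlinarith
        nlinarith

lemma exp_le_factorial (N : ℕ) : Real.exp (N * Real.log N - N) ≤ (N ! : ℝ) := by
  rcases Nat.eq_zero_or_pos N with rfl | hN
  · simp
  · have hN' : (0 : ℝ) < N := by exact_mod_cast hN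
    have h := Real.pow_div_factorial_le_exp (N : ℝ) hN'.le N
    rw [div_le_iff₀ (by exact_mod_cast Nat.factorial_pos N)] at h
    rw [Real.exp_sub, div_le_iff₀ (Real.exp_pos _), mul_comm (N : ℝ), Real.exp_mul,
      Real.exp_log hN', Real.rpow_natCast]
    linarith

/-- Multinomial coefficients are exponentially large at the rate given by the entropy. -/
lemma prod_factorial_le {ι : Type*} [Fintype ι] (M : ι → ℕ) {N : ℕ} (hN : 0 < N)
    (hM : ∑ i, M i = N) :
    ∏ i, ((M i)! : ℝ) ≤ N ! *
      Real.exp (Fintype.card ι * (2 * Real.log (N + 1) + 1) -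
        N * ∑ i, Real.negMulLog (M i / N)) := by
  have hN' : (0 : ℝ) < N := by exact_mod_cast hN
  have hMN : ∀ i, (M i : ℝ) ≤ N := fun i => by
    rw [← hM]
    exact_mod_cast Finset.single_le_sum (fun _ _ => Nat.zero_le _) (Finset.mem_univ i)
  have hM' : ∑ i, (M i : ℝ) = N := by exact_mod_cast hM
  calc ∏ i, ((M i)! : ℝ)
      ≤ ∏ i, Real.exp (M i * Real.log (M i) - M i + (2 * Real.log (N + 1) + 1)) := by
        refine Finset.prod_le_prod (fun _ _ => by positivity) fun i _ => ?_
        refine (factorial_le_exp _).trans (Real.exp_le_exp.2 ?_)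
        have := Real.log_le_log (by positivity : (0 : ℝ) < M i + 1)
          (by linarith [hMN i] : (M i : ℝ) + 1 ≤ N + 1)
        linarith
    _ = Real.exp (∑ i, (M i * Real.log (M i)) - N +
          Fintype.card ι * (2 * Real.log (N + 1) + 1)) := by
        rw [← Real.exp_sum]
        simp only [Finset.sum_add_distrib, Finset.sum_sub_distrib, hM', Finset.sum_const,
          Finset.card_univ, nsmul_eq_mul]
        congr 1
        ring
    _ = Real.exp (N * Real.log N - N) *
          Real.exp (Fintype.card ι * (2 * Real.log (N + 1) + 1) -
            N * ∑ i, Real.negMulLog (M i / N)) := by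
        rw [← Real.exp_add]
        congr 1
        have : (N : ℝ) * ∑ i, Real.negMulLog (M i / N) =
            N * Real.log N - ∑ i, (M i * Real.log (M i)) := by
          have e : (N : ℝ) * Real.log N = ∑ i, M i * Real.log N := by
            rw [← Finset.sum_mul, hM']
          rw [e, ← Finset.sum_sub_distrib, Finset.mul_sum]
          refine Finset.sum_congr rfl fun i _ => ?_
          rcases Nat.eq_zero_or_pos (M i) with h | h
          · simp [h]
          · have h' : (0 : ℝ) < M i := by exact_mod_cast h
            rw [Real.negMulLog, Real.log_div h'.ne' hN'.ne']
            field_simp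
            ring
        rw [this]
        ring
    _ ≤ _ := by
        gcongr
        exact exp_le_factorial N

end Stirling

/-! ### Counting graphs by their type statistics -/

section TypeMethod

open scoped Classical Nat
open SimpleGraph

/-- The color of a vertex together with the numbers of neighbors of each color. -/
abbrev VertexType (S : Type*) (d : ℕ) := S × (S → Fin (d + 1))

/-- The type of a vertex (correct when the degree of the vertex is at most `d`). -/
noncomputable def vertexType {V S : Type*} (d : ℕ) (G : SimpleGraph V) (f : V → S) (v : V) :
    VertexType S d :=
  (f v, fun b => Fin.ofNat (d + 1) (colorDegree G f v b))

variable {S : Type*} [Fintype S] {d : ℕ}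

/-- The number of orderings of the neighbors' colors compatible with a vertex type. -/
noncomputable def VertexType.orderings (x : VertexType S d) : ℝ :=
  d ! / ∏ b, ((x.2 b : ℕ)! : ℝ)

/-- The probability that a vertex of type `x` and a random neighbor of it are colored by `p`. -/
noncomputable def VertexType.edgeCoeff (x : VertexType S d) (p : S × S) : ℝ :=
  if x.1 = p.1 then ((x.2 p.2 : ℕ) : ℝ) / d else 0

/-- The law of the colors of a random directed edge, given the law of the vertex type. -/
noncomputable def edgeLaw (Q : VertexType S d → ℝ) (p : S × S) : ℝ :=
  ∑ x, x.edgeCoeff p * Q x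

/-- The exponential growth rate of the expected number of colorings with type statistics `Q`,
computed with the help of a reference law `r`. -/
noncomputable def growthRate (r Q : VertexType S d → ℝ) : ℝ :=
  ∑ x, Q x * (Real.log x.orderings - Real.log (r x)) -
    d / 2 * ∑ p, Real.negMulLog (edgeLaw Q p)

/-- The empirical distribution of a finite family. -/
noncomputable def empirical {V X : Type*} [Fintype V] (u : V → X) (x : X) : ℝ :=
  (Finset.card {v | u v = x} : ℝ) / Fintype.card V

lemma continuous_growthRate (r : VertexType S d → ℝ) : Continuous (growthRate r) := by
  unfold growthRate edgeLaw
  have := Real.continuous_negMulLog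
  fun_prop

lemma VertexType.orderings_pos (x : VertexType S d) : 0 < x.orderings := by
  unfold VertexType.orderings
  positivity

variable {V : Type*} [Fintype V]

lemma sum_comp_eq_card_mul_sum_empirical {X : Type*} [Fintype X] (u : V → X) (h : X → ℝ)
    (hV : 0 < Fintype.card V) :
    ∑ v, h (u v) = Fintype.card V * ∑ x, empirical u x * h x := by
  have hV' : (Fintype.card V : ℝ) ≠ 0 := by exact_mod_cast hV.ne'
  rw [Finset.mul_sum, ← Finset.sum_fiberwise (s := Finset.univ) (g := u) (f := fun v => h (u v))]
  refine Finset.sum_congr rfl fun x _ => ?_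
  rw [Finset.sum_congr rfl (g := fun _ => h x)
    (fun v hv => by rw [(Finset.mem_filter.1 hv).2]), Finset.sum_const, nsmul_eq_mul, empirical]
  field_simp

lemma typeCount_div_eq_edgeLaw (hd : 0 < d) (hV : 0 < Fintype.card V)
    (u : V → VertexType S d) (p : S × S) :
    (typeCount (fun v => (u v).1) (fun q => ((u q.1).2 q.2 : ℕ)) p : ℝ) /
      (Fintype.card V * d : ℕ) = edgeLaw (empirical u) p := by
  have hV' : (Fintype.card V : ℝ) ≠ 0 := by exact_mod_cast hV.ne'
  have hd' : (d : ℝ) ≠ 0 := by exact_mod_cast hd.ne'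
  have h := sum_comp_eq_card_mul_sum_empirical u (fun x => x.edgeCoeff p) hV
  have h2 : (typeCount (fun v => (u v).1) (fun q => ((u q.1).2 q.2 : ℕ)) p : ℝ) =
      d * ∑ v, (u v).edgeCoeff p := by
    rw [typeCount, Nat.cast_sum, Finset.mul_sum]
    refine Finset.sum_congr rfl fun v _ => ?_
    rw [VertexType.edgeCoeff]
    split_ifs
    · field_simp
    · simp
  rw [h2, h, edgeLaw]
  push_cast
  rw [Finset.sum_congr rfl fun x _ => mul_comm (empirical u x) _]
  field_simp

/-- The number of graphs in which every vertex has a prescribed type. -/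
lemma card_graphs_of_types_le {K : ℕ} (hd : 0 < d) (hK : d + d ^ 2 = 2 * K)
    (hn : 2 * (d + 1) * (d + 1) + (2 * K + 2) < Fintype.card V)
    (heven : Even (Fintype.card V * d)) (u : V → VertexType S d)
    (hu : ∀ v, ∑ b, ((u v).2 b : ℕ) = d) (r : VertexType S d → ℝ) (hr : ∀ x, 0 < r x) :
    ((graphsWithColorDegrees (fun v => (u v).1) (fun q => ((u q.1).2 q.2 : ℕ))).card : ℝ) ≤
      (deficientGraphs V d 0).card * (2 ^ K * K ! * (Fintype.card V : ℝ) ^ (4 * K) *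
        Real.exp (Fintype.card (S × S) * (Real.log ((Fintype.card V * d : ℕ) + 1) + 1 / 2))) *
      ((∏ v, r (u v)) * Real.exp (Fintype.card V * growthRate r (empirical u))) := by
  have hV : 0 < Fintype.card V := by omega
  set n := Fintype.card V with hndef
  set f : V → S := fun v => (u v).1
  set τ : V × S → ℕ := fun q => ((u q.1).2 q.2 : ℕ)
  set A : ℝ := ((graphsWithColorDegrees f τ).card : ℝ)
  have hN : 0 < n * d := Nat.mul_pos hV hd
  have hupper := card_graphsWithColorDegrees_mul_le f τ
  have hsum : ∑ p, typeCount f τ p = n * d := by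
    rw [Fintype.sum_prod_type]
    simp only [typeCount]
    have : ∀ a : S, ∑ b : S, ∑ v, (if f v = a then τ (v, b) else 0) =
        ∑ v, if f v = a then d else 0 := by
      intro a
      rw [Finset.sum_comm]
      refine Finset.sum_congr rfl fun v _ => ?_
      split_ifs
      · exact hu v
      · simp
    rw [Finset.sum_congr rfl fun a _ => this a, Finset.sum_comm]
    simp [hndef]
  have hmult := prod_factorial_le (typeCount f τ) hN hsum
  have hlower := sqrt_factorial_le_card_regular hd hK hn heven
  set c : ℝ := (Fintype.card (S × S) : ℝ) with hc
  set L : ℝ := Real.log ((n * d : ℕ) + 1) with hL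
  set H : ℝ := ∑ p, Real.negMulLog (edgeLaw (empirical u) p) with hH
  have hH' : ∑ p, Real.negMulLog ((typeCount f τ p : ℝ) / (n * d : ℕ)) = H :=
    Finset.sum_congr rfl fun p _ => by rw [← typeCount_div_eq_edgeLaw hd hV u p]
  rw [hH'] at hmult
  -- The square root halves the exponent, of leading term `n * d` times the edge entropy; this is
  -- the origin of `d / 2` in `growthRate`.
  have hsq : √(∏ p, ((typeCount f τ p)! : ℝ)) ≤
      √((n * d)! : ℝ) * Real.exp ((c * (2 * L + 1) - (n * d : ℕ) * H) / 2) := by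
    refine (Real.sqrt_le_sqrt hmult).trans (le_of_eq ?_)
    rw [Real.sqrt_mul (by positivity), Real.exp_half]
  have hτ : ∏ q, ((τ q)! : ℝ) = ∏ v, ∏ b, (((u v).2 b : ℕ)! : ℝ) := by
    rw [Fintype.prod_prod_type]
  -- The factor (d!)^n from the regular graphs and the factorials of the prescribed degrees combine
  -- into one multinomial coefficient per vertex.
  have hord : (d ! : ℝ) ^ n = (∏ q, ((τ q)! : ℝ)) * ∏ v, (u v).orderings := by
    rw [hτ, ← Finset.prod_mul_distrib]
    have : ∀ v : V, (∏ b, (((u v).2 b : ℕ)! : ℝ)) * (u v).orderings = d ! := by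
      intro v
      rw [VertexType.orderings]
      field_simp
    simp [this, hndef]
  have hord2 : ∏ v, (u v).orderings =
      (∏ v, r (u v)) * Real.exp (n * ∑ x, empirical u x *
        (Real.log x.orderings - Real.log (r x))) := by
    rw [← sum_comp_eq_card_mul_sum_empirical u _ hV, Real.exp_sum, ← Finset.prod_mul_distrib]
    refine Finset.prod_congr rfl fun v _ => ?_
    rw [Real.exp_sub, Real.exp_log (VertexType.orderings_pos _), Real.exp_log (hr _)]
    field_simp [(hr (u v)).ne']
  have hτpos : 0 < ∏ q, ((τ q)! : ℝ) := by positivity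
  refine le_of_mul_le_mul_right ?_ hτpos
  calc A * ∏ q, ((τ q)! : ℝ) ≤ √(∏ p, ((typeCount f τ p)! : ℝ)) := hupper
    _ ≤ √((n * d)! : ℝ) * Real.exp ((c * (2 * L + 1) - (n * d : ℕ) * H) / 2) := hsq
    _ ≤ ((deficientGraphs V d 0).card * ((d ! : ℝ) ^ n * (2 ^ K * K ! * (n : ℝ) ^ (4 * K)))) *
          Real.exp ((c * (2 * L + 1) - (n * d : ℕ) * H) / 2) := by gcongr
    _ = _ := by
        rw [hord, hord2, growthRate, ← hH]
        have : (n : ℝ) * (∑ x, empirical u x * (Real.log x.orderings - Real.log (r x)) -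
            d / 2 * H) + c * (L + 1 / 2) =
            n * (∑ x, empirical u x * (Real.log x.orderings - Real.log (r x))) +
            (c * (2 * L + 1) - (n * d : ℕ) * H) / 2 := by
          push_cast
          ring
        have h2 := congrArg Real.exp this
        rw [Real.exp_add, Real.exp_add] at h2
        linear_combination (- ((deficientGraphs V d 0).card * (2 ^ K * K ! * (n : ℝ) ^ (4 * K)) *
          (∏ v, r (u v)) * ∏ q, ((τ q)! : ℝ))) * h2

/-- The number of graphs having a coloring whose type statistics have a negative growth rate is
small. -/
lemma card_graphs_of_growthRate_le {K : ℕ} (hd : 0 < d) (hK : d + d ^ 2 = 2 * K)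
    (hn : 2 * (d + 1) * (d + 1) + (2 * K + 2) < Fintype.card V)
    (heven : Even (Fintype.card V * d)) (r : VertexType S d → ℝ) (hr : ∀ x, 0 < r x)
    (hr1 : ∑ x, r x ≤ 1) (κ : ℝ) (𝒢 : Finset (SimpleGraph V))
    (h𝒢 : ∀ G ∈ 𝒢, (∀ v, vertexDegree G v = d) ∧
      ∃ f : V → S, growthRate r (empirical (vertexType d G f)) ≤ -κ) :
    (𝒢.card : ℝ) ≤
      (deficientGraphs V d 0).card * (2 ^ K * K ! * (Fintype.card V : ℝ) ^ (4 * K) *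
        Real.exp (Fintype.card (S × S) * (Real.log ((Fintype.card V * d : ℕ) + 1) + 1 / 2))) *
      Real.exp (-(Fintype.card V * κ)) := by
  set B : ℝ := (deficientGraphs V d 0).card * (2 ^ K * K ! * (Fintype.card V : ℝ) ^ (4 * K) *
        Real.exp (Fintype.card (S × S) * (Real.log ((Fintype.card V * d : ℕ) + 1) + 1 / 2)))
    with hB
  have hB0 : 0 ≤ B := by positivity
  set U : Finset (V → VertexType S d) := {u | (∀ v, ∑ b, ((u v).2 b : ℕ) = d) ∧
    growthRate r (empirical u) ≤ -κ} with hU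
  have hsub : 𝒢 ⊆ U.biUnion fun u =>
      graphsWithColorDegrees (fun v => (u v).1) (fun q => ((u q.1).2 q.2 : ℕ)) := by
    intro G hG
    obtain ⟨hreg, f, hf⟩ := h𝒢 G hG
    have hsumdeg : ∀ v, ∑ b, colorDegree G f v b = d := by
      intro v
      rw [← hreg v, vertexDegree_eq_sum]
      simp only [colorDegree_eq_sum]
      rw [Finset.sum_comm]
      refine Finset.sum_congr rfl fun w _ => ?_
      by_cases h : G.Adj v w <;> simp [h]
    have hle : ∀ v b, colorDegree G f v b ≤ d := fun v b => by
      rw [← hsumdeg v]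
      exact Finset.single_le_sum (fun _ _ => Nat.zero_le _) (Finset.mem_univ b)
    have hval : ∀ v b, ((vertexType d G f v).2 b : ℕ) = colorDegree G f v b := fun v b => by
      simp only [vertexType, Fin.val_ofNat]
      exact Nat.mod_eq_of_lt (Nat.lt_succ_of_le (hle v b))
    rw [Finset.mem_biUnion]
    refine ⟨vertexType d G f, ?_, ?_⟩
    · rw [hU, Finset.mem_filter]
      refine ⟨Finset.mem_univ _, fun v => ?_, hf⟩
      simp only [hval, hsumdeg]
    · rw [mem_graphsWithColorDegrees]
      exact fun v b => (hval v b).symm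
  calc (𝒢.card : ℝ) ≤ ∑ u ∈ U,
        ((graphsWithColorDegrees (fun v => (u v).1) (fun q => ((u q.1).2 q.2 : ℕ))).card : ℝ) := by
        exact_mod_cast (Finset.card_le_card hsub).trans Finset.card_biUnion_le
    _ ≤ ∑ u ∈ U, B * ((∏ v, r (u v)) * Real.exp (-(Fintype.card V * κ))) := by
        refine Finset.sum_le_sum fun u hu => ?_
        rw [hU, Finset.mem_filter] at hu
        refine (card_graphs_of_types_le hd hK hn heven u hu.2.1 r hr).trans ?_
        refine mul_le_mul_of_nonneg_left ?_ hB0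
        refine mul_le_mul_of_nonneg_left (Real.exp_le_exp.2 ?_)
          (Finset.prod_nonneg fun _ _ => (hr _).le)
        have := mul_le_mul_of_nonneg_left hu.2.2 (Nat.cast_nonneg (α := ℝ) (Fintype.card V))
        linarith
    -- Enlarging the sum to all type assignments costs nothing: the weights `r (u v)` factor over
    -- the vertices, so their total is (∑ r)^n ≤ 1. The reference law thus replaces a count of the
    -- assignments with given statistics.
    _ ≤ ∑ u : V → VertexType S d, B * ((∏ v, r (u v)) * Real.exp (-(Fintype.card V * κ))) := by
        refine Finset.sum_le_sum_of_subset_of_nonneg (Finset.subset_univ _) fun u _ _ => ?_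
        have : 0 ≤ ∏ v, r (u v) := Finset.prod_nonneg fun v _ => (hr (u v)).le
        positivity
    _ = B * ((∑ x, r x) ^ Fintype.card V * Real.exp (-(Fintype.card V * κ))) := by
        rw [← Finset.mul_sum, ← Finset.sum_mul]
        congr 2
        have := Finset.sum_prod_piFinset (ι := V) Finset.univ fun _ => r
        rw [Fintype.piFinset_univ] at this
        rw [this, Finset.prod_const, Finset.card_univ]
    _ ≤ B * (1 * Real.exp (-(Fintype.card V * κ))) := by
        refine mul_le_mul_of_nonneg_left (mul_le_mul_of_nonneg_right ?_ (Real.exp_pos _).le) hB0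
        exact pow_le_one₀ (Finset.sum_nonneg fun x _ => (hr x).le) hr1
    _ = _ := by rw [one_mul]

end TypeMethod

/-! ### The first moment method on random regular graphs -/

section FirstMoment

open scoped Classical Nat
open SimpleGraph

lemma eventually_poly_mul_exp_le_half (d K c : ℕ) {κ : ℝ} (hκ : 0 < κ) :
    ∀ᶠ n : ℕ in atTop, (2 ^ K * K ! * (n : ℝ) ^ (4 * K) *
      Real.exp (c * (Real.log ((n * d : ℕ) + 1) + 1 / 2))) * Real.exp (-(n * κ)) ≤ 1 / 2 := by
  set C : ℝ := 2 ^ K * K ! * ((d + 1 : ℕ) : ℝ) ^ c * Real.exp (c * (1 / 2)) with hC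
  have hr : |Real.exp (-κ)| < 1 := by
    rw [abs_of_pos (Real.exp_pos _), Real.exp_lt_one_iff]
    linarith
  have h := (tendsto_pow_const_mul_const_pow_of_abs_lt_one (4 * K + c) hr).const_mul C
  rw [mul_zero] at h
  filter_upwards [h.eventually (Iic_mem_nhds (by norm_num : (0 : ℝ) < 1 / 2)),
    eventually_ge_atTop 1] with n hn h1
  refine le_trans ?_ hn
  have e1 : Real.exp (c * (Real.log ((n * d : ℕ) + 1) + 1 / 2)) =
      ((n * d : ℕ) + 1 : ℝ) ^ c * Real.exp (c * (1 / 2)) := by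
    rw [mul_add, Real.exp_add, mul_comm (c : ℝ) (Real.log _), Real.exp_mul,
      Real.exp_log (by positivity), Real.rpow_natCast]
  have e2 : Real.exp (-(n * κ)) = Real.exp (-κ) ^ n := by
    rw [← Real.exp_nat_mul]
    congr 1
    ring
  have e3 : ((n * d : ℕ) + 1 : ℝ) ≤ n * (d + 1 : ℕ) := by
    have : n * d + 1 ≤ n * (d + 1) := by rw [mul_add]; omega
    exact_mod_cast this
  rw [e1, e2]
  calc (2 ^ K * K ! * (n : ℝ) ^ (4 * K) *
        (((n * d : ℕ) + 1 : ℝ) ^ c * Real.exp (c * (1 / 2)))) * Real.exp (-κ) ^ n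
      ≤ (2 ^ K * K ! * (n : ℝ) ^ (4 * K) *
        ((n * (d + 1 : ℕ) : ℝ) ^ c * Real.exp (c * (1 / 2)))) * Real.exp (-κ) ^ n := by
        gcongr
    _ = C * ((n : ℝ) ^ (4 * K + c) * Real.exp (-κ) ^ n) := by
        rw [hC, mul_pow, pow_add]
        ring

lemma mem_regularGraphs_iff {d n : ℕ} {G : SimpleGraph (Fin n)} :
    G ∈ regularGraphs d n ↔ ∀ v, vertexDegree G v = d := by
  refine forall_congr' fun v => ?_
  rw [vertexDegree, Set.ncard_eq_toFinset_card', ← SimpleGraph.card_neighborFinset_eq_degree]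
  rw [SimpleGraph.neighborFinset]

lemma regularGraphs_eq_deficientGraphs (d n : ℕ) :
    regularGraphs d n = (deficientGraphs (Fin n) d 0 : Set (SimpleGraph (Fin n))) := by
  ext G
  rw [mem_regularGraphs_iff, Finset.mem_coe, mem_deficientGraphs]
  have hc : Fintype.card (Fin n) * d = ∑ _v : Fin n, d := by simp
  rw [hc, mul_zero, add_zero]
  constructor
  · intro h
    exact ⟨fun v => (h v).le, Finset.sum_congr rfl fun v _ => h v⟩
  · rintro ⟨h1, h2⟩ v
    exact (Finset.sum_eq_sum_iff_of_le fun v _ => h1 v).1 h2 v (Finset.mem_univ v)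

lemma even_mul_of_mem_regularGraphs {d n : ℕ} {G : SimpleGraph (Fin n)}
    (hG : G ∈ regularGraphs d n) : Even (n * d) := by
  have h := G.sum_degrees_eq_twice_card_edges
  have hG' : ∀ v, G.degree v = d := fun v => by
    convert hG v
  rw [Finset.sum_congr rfl fun v _ => hG' v] at h
  simp at h
  exact ⟨_, by rw [h]; ring⟩

instance (n : ℕ) : MeasurableSingletonClass (SimpleGraph (Fin n)) where
  measurableSet_singleton G := by
    have : ({G} : Set (SimpleGraph (Fin n))) =
        ⋂ u, ⋂ v, (fun H : SimpleGraph (Fin n) => H.Adj u v) ⁻¹' {G.Adj u v} := by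
      ext H
      simp only [Set.mem_singleton_iff, Set.mem_iInter, Set.mem_preimage]
      exact ⟨fun h => by simp [h], fun h => SimpleGraph.ext (funext₂ h)⟩
    rw [this]
    refine MeasurableSet.iInter fun u => MeasurableSet.iInter fun v => ?_
    exact (measurable_iff_adj.1 measurable_id u v) (measurableSet_singleton _)

variable {S : Type*} [Fintype S] {d : ℕ}

/-- If the growth rate at `P` is negative, then it is unlikely that a random regular graph has a
coloring with type statistics close to `P`. -/
lemma exists_uniformOn_regularGraphs_le_half (hd : 0 < d) (P r : VertexType S d → ℝ)
    (hr : ∀ x, 0 < r x) (hr1 : ∑ x, r x ≤ 1) (hP : growthRate r P < 0) :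
    ∃ η > 0, ∀ᶠ n : ℕ in atTop, (regularGraphs d n).Nonempty →
      uniformOn (regularGraphs d n) {G | ∃ f : Fin n → S, ∀ x,
        |empirical (vertexType d G f) x - P x| < η} ≤ 1 / 2 := by
  -- With half of the negative rate kept in reserve, continuity keeps the rate at most `-κ` on the
  -- `η`-ball around `P`.
  set κ : ℝ := -growthRate r P / 2 with hκ
  have hκ0 : 0 < κ := by rw [hκ]; linarith
  obtain ⟨η, hη, hball⟩ := Metric.continuousAt_iff.1
    ((continuous_growthRate r).continuousAt (x := P)) κ hκ0
  obtain ⟨K, hK⟩ : Even (d + d ^ 2) := by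
    have := Nat.even_mul_succ_self d
    rwa [show d + d ^ 2 = d * (d + 1) by ring]
  have hK : d + d ^ 2 = 2 * K := by omega
  refine ⟨η, hη, ?_⟩
  filter_upwards [eventually_poly_mul_exp_le_half d K (Fintype.card (S × S)) hκ0,
    eventually_gt_atTop (2 * (d + 1) * (d + 1) + (2 * K + 2))] with n hn hlarge hne
  set A : Set (SimpleGraph (Fin n)) := {G | ∃ f : Fin n → S, ∀ x,
        |empirical (vertexType d G f) x - P x| < η} with hA
  rw [regularGraphs_eq_deficientGraphs] at hne ⊢
  obtain ⟨G₀, hG₀⟩ := hne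
  have heven : Even (Fintype.card (Fin n) * d) := by
    rw [Fintype.card_fin]
    exact even_mul_of_mem_regularGraphs (G := G₀) (by
      rw [regularGraphs_eq_deficientGraphs]; exact hG₀)
  have hcard : ((deficientGraphs (Fin n) d 0 ∩ A.toFinset).card : ℝ) ≤
      (deficientGraphs (Fin n) d 0).card * (1 / 2) := by
    refine (card_graphs_of_growthRate_le (K := K) hd hK (by simpa using hlarge) heven r hr hr1 κ _
      ?_).trans ?_
    · intro G hG
      rw [Finset.mem_inter, Set.mem_toFinset] at hG
      obtain ⟨hG1, f, hf⟩ := hG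
      refine ⟨mem_regularGraphs_iff.1 (by rw [regularGraphs_eq_deficientGraphs]; exact hG1),
        f, ?_⟩
      have hdist : dist (empirical (vertexType d G f)) P < η :=
        (dist_pi_lt_iff hη).2 fun x => by rw [Real.dist_eq]; exact hf x
      have := hball hdist
      rw [Real.dist_eq, abs_lt] at this
      rw [hκ] at this ⊢
      linarith [this.2]
    · rw [mul_assoc]
      refine mul_le_mul_of_nonneg_left ?_ (Nat.cast_nonneg _)
      simpa using hn
  have h2 : 2 * (deficientGraphs (Fin n) d 0 ∩ A.toFinset).card ≤
      (deficientGraphs (Fin n) d 0).card := by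
    have : (2 * (deficientGraphs (Fin n) d 0 ∩ A.toFinset).card : ℝ) ≤
      (deficientGraphs (Fin n) d 0).card := by linarith
    exact_mod_cast this
  rw [← Set.coe_toFinset A, uniformOn_apply_finset]
  refine ENNReal.div_le_of_le_mul ?_
  calc ((deficientGraphs (Fin n) d 0 ∩ A.toFinset).card : ENNReal)
      = 1 / 2 * (2 * (deficientGraphs (Fin n) d 0 ∩ A.toFinset).card) := by
        rw [← mul_assoc, one_div, ENNReal.inv_mul_cancel (by simp) (by simp), one_mul]
    _ ≤ 1 / 2 * (deficientGraphs (Fin n) d 0).card := by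
        gcongr
        exact_mod_cast h2

/-- Independent events of probability at most `1 / 2` cannot hold from some index on. -/
lemma ae_not_eventually_of_le_half {X : ℕ → Type*} [∀ i, MeasurableSpace (X i)]
    (ν : ∀ i, Measure (X i)) [∀ i, IsProbabilityMeasure (ν i)] (A : ∀ i, Set (X i))
    (hA : ∀ i, MeasurableSet (A i)) (h : ∀ᶠ i in atTop, ν i (A i) ≤ 1 / 2) :
    ∀ᵐ x ∂(Measure.infinitePi ν), ¬ ∀ᶠ i in atTop, x i ∈ A i := by
  obtain ⟨N, hN⟩ := eventually_atTop.1 h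
  have hnull : ∀ M, Measure.infinitePi ν {x | ∀ i ≥ M, x i ∈ A i} = 0 := by
    intro M
    -- Only `k` coordinates past both thresholds are retained; independence bounds the probability
    -- by (1/2)^k for every `k`.
    have hle : ∀ k : ℕ, Measure.infinitePi ν {x | ∀ i ≥ M, x i ∈ A i} ≤ (1 / 2) ^ k := by
      intro k
      calc Measure.infinitePi ν {x | ∀ i ≥ M, x i ∈ A i}
          ≤ Measure.infinitePi ν (Set.pi (Finset.Ico (max M N) (max M N + k) : Set ℕ) A) := by
            refine measure_mono fun x hx i hi => hx i ?_
            simp only [Finset.coe_Ico, Set.mem_Ico] at hi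
            omega
        _ = ∏ i ∈ Finset.Ico (max M N) (max M N + k), ν i (A i) :=
            Measure.infinitePi_pi _ fun i _ => hA i
        _ ≤ ∏ _i ∈ Finset.Ico (max M N) (max M N + k), (1 / 2 : ENNReal) := by
            refine Finset.prod_le_prod' fun i hi => hN i ?_
            rw [Finset.mem_Ico] at hi
            omega
        _ = (1 / 2) ^ k := by simp
    have htend := ENNReal.tendsto_pow_atTop_nhds_zero_of_lt_one
      (by rw [one_div]; exact ENNReal.one_half_lt_one : (1 / 2 : ENNReal) < 1)
    exact le_antisymm (ge_of_tendsto' htend hle) zero_le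
  rw [ae_iff]
  refine measure_mono_null (fun x hx => ?_) (measure_iUnion_null hnull)
  simp only [Set.mem_ofPred_eq, not_not] at hx
  obtain ⟨M, hM⟩ := eventually_atTop.1 hx
  exact Set.mem_iUnion.2 ⟨M, hM⟩

end FirstMoment

/-! ### Local limits and vertex type statistics -/

section LocalLimits

open scoped Classical
open SimpleGraph

variable {V W S : Type*}

lemma mem_closedGraphBall_one {G : SimpleGraph V} {v w : V} :
    w ∈ closedGraphBall G v 1 ↔ G.Adj v w ∨ v = w := by
  rw [← edist_le_one_iff_adj_or_eq]
  simp [closedGraphBall]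

lemma SameColoredBall.color_eq {r : ℕ} {G : SimpleGraph V} {v : V} {f : V → S} {H : SimpleGraph W}
    {w : W} {g : W → S} (h : SameColoredBall r G v f H w g) : f v = g w := by
  obtain ⟨e, he, hcol⟩ := h
  have hv : v ∈ closedGraphBall G v r := by simp [closedGraphBall]
  rw [← hcol ⟨v, hv⟩, (he ⟨v, hv⟩).1 rfl]

lemma SameColoredBall.of_eqOn {r : ℕ} {T : SimpleGraph V} {o : V} {f g : V → S}
    (h : Set.EqOn f g (closedGraphBall T o r)) : SameColoredBall r T o f T o g :=
  ⟨Iso.refl, fun _ => Iff.rfl, fun x => (h x.2).symm⟩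

lemma SameColoredBall.colorDegree_eq {G : SimpleGraph V} {v : V} {f : V → S} {H : SimpleGraph W}
    {w : W} {g : W → S} (h : SameColoredBall 1 G v f H w g) (b : S) :
    colorDegree G f v b = colorDegree H g w b := by
  obtain ⟨e, he, hcol⟩ := h
  have hv : v ∈ closedGraphBall G v 1 := by simp [closedGraphBall]
  have hew : (e ⟨v, hv⟩ : W) = w := (he ⟨v, hv⟩).1 rfl
  have hw : w ∈ closedGraphBall H w 1 := by simp [closedGraphBall]
  have hsub : ∀ x, G.Adj v x → x ∈ closedGraphBall G v 1 := fun x hx =>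
    mem_closedGraphBall_one.2 (Or.inl hx)
  have hadj : ∀ x (hx : x ∈ closedGraphBall G v 1), H.Adj w (e ⟨x, hx⟩) ↔ G.Adj v x := by
    intro x hx
    have := e.map_adj_iff (v := ⟨v, hv⟩) (w := ⟨x, hx⟩)
    simpa [hew] using this
  refine Set.ncard_congr (fun x hx => (e ⟨x, hsub x hx.1⟩ : W)) ?_ ?_ ?_
  · intro x hx
    exact ⟨(hadj x _).2 hx.1, by rw [hcol]; exact hx.2⟩
  · intro x y hx hy hxy
    simpa using e.injective (Subtype.ext hxy)
  · intro y hy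
    have hyb : y ∈ closedGraphBall H w 1 := mem_closedGraphBall_one.2 (Or.inl hy.1)
    obtain ⟨⟨x, hx⟩, hxy⟩ := e.surjective ⟨y, hyb⟩
    have hxy' : (e ⟨x, hx⟩ : W) = y := congrArg Subtype.val hxy
    refine ⟨x, ⟨(hadj x hx).1 (hxy' ▸ hy.1), ?_⟩, hxy'⟩
    have := hcol ⟨x, hx⟩
    rw [hxy'] at this
    exact this ▸ hy.2

lemma SameColoredBall.vertexType_eq {d : ℕ} {G : SimpleGraph V} {v : V} {f : V → S}
    {H : SimpleGraph W} {w : W} {g : W → S} (h : SameColoredBall 1 G v f H w g) :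
    vertexType d G f v = vertexType d H g w := by
  simp only [vertexType, h.color_eq, h.colorDegree_eq]

lemma colorDegree_le_of_isRegular {T : SimpleGraph V} [T.LocallyFinite] {d : ℕ}
    (hreg : T.IsRegularOfDegree d) (f : V → S) (v : V) (b : S) : colorDegree T f v b ≤ d := by
  rw [← hreg v, ← card_neighborFinset_eq_degree, ← Set.ncard_coe_finset]
  exact Set.ncard_le_ncard (fun w hw => by simpa using hw.1) (Finset.finite_toSet _)

lemma coe_vertexType_snd {T : SimpleGraph V} [T.LocallyFinite] {d : ℕ}
    (hreg : T.IsRegularOfDegree d) (f : V → S) (v : V) (b : S) :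
    ((vertexType d T f v).2 b : ℕ) = colorDegree T f v b := by
  simp only [vertexType, Fin.val_ofNat]
  exact Nat.mod_eq_of_lt (Nat.lt_succ_of_le (colorDegree_le_of_isRegular hreg f v b))

/-- In a regular tree, the vertex type determines the isomorphism class of the colored star. -/
lemma sameColoredBall_one_of_vertexType_eq {T : SimpleGraph V} [T.LocallyFinite] (hT : T.IsTree)
    {d : ℕ} (hreg : T.IsRegularOfDegree d) {o : V} {f g : V → S}
    (h : vertexType d T f o = vertexType d T g o) : SameColoredBall 1 T o f T o g := by
  have hfib : ∀ b : S, Nonempty ({w : T.neighborSet o // f w = b} ≃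
      {w : T.neighborSet o // g w = b}) := by
    intro b
    have key : ∀ f : V → S, Nat.card {w : T.neighborSet o // f w = b} = colorDegree T f o b := by
      intro f
      rw [colorDegree, ← Nat.card_coe_set_eq]
      exact Nat.card_congr (Equiv.subtypeSubtypeEquivSubtypeInter (fun w => T.Adj o w)
        fun w => f w = b)
    rw [← Finite.card_eq, key, key, ← coe_vertexType_snd hreg, ← coe_vertexType_snd hreg, h]
  -- Equal color counts give a color-preserving permutation of the neighbors. Extended to an
  -- automorphism fixing `o`, it restricts to the ball.
  let σ : T.neighborSet o ≃ T.neighborSet o :=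
    Equiv.ofFiberEquiv (f := fun w => f w) (g := fun w => g w) fun b => (hfib b).some
  have hσ : ∀ w, g (σ w) = f w := Equiv.ofFiberEquiv_map (f := fun w : T.neighborSet o => f w)
    (g := fun w : T.neighborSet o => g w) fun b => (hfib b).some
  obtain ⟨Φ, hΦo, hΦ⟩ := hT.exists_iso_extending hreg σ
  have hbij : Set.BijOn Φ (closedGraphBall T o 1) (closedGraphBall T o 1) := by
    refine ⟨?_, Φ.injective.injOn, ?_⟩
    · intro x hx
      rw [mem_closedGraphBall_one] at hx ⊢
      rcases hx with hx | rfl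
      · left
        rw [← hΦo]
        exact Φ.map_adj_iff.2 hx
      · exact Or.inr hΦo.symm
    · intro y hy
      rw [mem_closedGraphBall_one] at hy
      refine ⟨Φ.symm y, ?_, Φ.apply_symm_apply y⟩
      rw [mem_closedGraphBall_one]
      rcases hy with hy | rfl
      · left
        rw [← Φ.map_adj_iff, hΦo, Φ.apply_symm_apply]
        exact hy
      · right
        rw [← Φ.injective.eq_iff, hΦo, Φ.apply_symm_apply]
  refine ⟨Φ.induce hbij, fun x => ?_, fun x => ?_⟩
  · show (x : V) = o ↔ Φ x = o
    exact (Φ.injective.eq_iff' hΦo).symm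
  · show g (Φ x) = f x
    rcases mem_closedGraphBall_one.1 x.2 with hx | hx
    · rw [hΦ ⟨x, hx⟩, hσ]
    · rw [← hx, hΦo]
      exact (congrArg Prod.fst h).symm

variable [Fintype S] [MeasurableSpace S]

/-- If `n i < N` infinitely often, no vertex of these graphs has an `N`-ball isomorphic to that of
the tree, which has more than `N` vertices. Every limiting ball probability of radius `N` would
vanish, although finitely many colored balls exhaust the probability space. -/
lemma BenjaminiSchrammConverges.tendsto_atTop {T : SimpleGraph V} [T.LocallyFinite] (hT : T.IsTree)
    {d : ℕ} (hd : 2 ≤ d) (hreg : T.IsRegularOfDegree d) {n : ℕ → ℕ}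
    {G : ∀ i, SimpleGraph (Fin (n i))} {f : ∀ i, Fin (n i) → S} {μ : Measure (V → S)}
    [IsProbabilityMeasure μ] (h : BenjaminiSchrammConverges T G f μ) : Tendsto n atTop atTop := by
  obtain ⟨o⟩ := hT.connected.nonempty
  rw [Filter.tendsto_atTop]
  intro N
  by_contra hN
  have hN : ∃ᶠ i in atTop, n i < N := by
    simpa [Filter.Frequently] using hN
  have hempty : ∀ i, n i < N → ∀ c : V → S, {v | SameColoredBall N (G i) v (f i) T o c} = ∅ := by
    intro i hi c
    rw [Set.eq_empty_iff_forall_notMem]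
    rintro v ⟨e, -⟩
    have h1 := hT.card_closedGraphBall hd hreg o N
    have h2 : (closedGraphBall T o N).ncard = (closedGraphBall (G i) v N).ncard := by
      rw [← Nat.card_coe_set_eq, ← Nat.card_coe_set_eq]
      exact Nat.card_congr e.toEquiv.symm
    have h3 := Set.ncard_le_card (closedGraphBall (G i) v N)
    rw [Nat.card_fin] at h3
    omega
  have hzero : ∀ c : V → S, μ {ω | SameColoredBall N T o ω T o c} = 0 := by
    intro c
    have h1 : μ.real {ω | SameColoredBall N T o ω T o c} = 0 := by
      refine tendsto_nhds_unique_of_frequently_eq (h o N c) tendsto_const_nhds (hN.mono ?_)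
      intro i hi
      simp [hempty i hi c]
    exact (measureReal_eq_zero_iff).1 h1
  obtain ⟨ω₀⟩ : Nonempty (V → S) := by
    by_contra hne
    rw [not_nonempty_iff] at hne
    exact IsProbabilityMeasure.ne_zero μ (Measure.eq_zero_of_isEmpty μ)
  have hfin := IsTree.finite_closedGraphBall (T := T) o N
  have : Finite (closedGraphBall T o N) := hfin
  have huniv : μ Set.univ = 0 := by
    refine measure_mono_null (fun ω _ => ?_)
      (measure_iUnion_null fun g : closedGraphBall T o N → S => hzero fun v => if hv : v ∈ closedGraphBall T o N then g ⟨v, hv⟩ else ω₀ v)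
    refine Set.mem_iUnion.2 ⟨fun v => ω v, ?_⟩
    rw [Set.mem_ofPred_eq]
    refine SameColoredBall.of_eqOn fun v hv => ?_
    simp only [dif_pos hv]
  simp at huniv

variable [MeasurableSingletonClass S]

lemma measurable_vertexType (T : SimpleGraph V) [T.LocallyFinite] (d : ℕ) (o : V) :
    Measurable fun f : V → S => vertexType d T f o := by
  have hdeg : ∀ b, Measurable fun f : V → S => colorDegree T f o b := by
    intro b
    have : (fun f : V → S => colorDegree T f o b) = fun f =>
        ∑ w ∈ T.neighborFinset o, if f w = b then 1 else 0 := by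
      funext f
      rw [Finset.sum_boole, colorDegree, ← Set.ncard_coe_finset]
      simp
    rw [this]
    refine Finset.measurable_sum _ fun w _ => ?_
    exact Measurable.ite (measurableSet_eq_fun (measurable_pi_apply w) measurable_const)
      measurable_const measurable_const
  refine (measurable_pi_apply o).prodMk (measurable_pi_lambda _ fun b => ?_)
  exact (measurable_of_countable (Fin.ofNat (d + 1))).comp (hdeg b)

/-- The law of the type of the vertex `o`. -/
noncomputable def typeLaw (T : SimpleGraph V) (d : ℕ) (μ : Measure (V → S)) (o : V)
    (x : VertexType S d) : ℝ :=
  μ.real {f | vertexType d T f o = x}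

lemma sum_typeLaw (T : SimpleGraph V) [T.LocallyFinite] (d : ℕ) (μ : Measure (V → S))
    [IsProbabilityMeasure μ] (o : V) : ∑ x, typeLaw T d μ o x = 1 := by
  have := sum_measureReal_preimage_singleton (μ := μ) Finset.univ
    (f := fun f : V → S => vertexType d T f o)
    (fun x _ => measurable_vertexType T d o (measurableSet_singleton x))
  simp only [Finset.coe_univ, Set.preimage_univ, probReal_univ] at this
  exact this

lemma sum_empirical {U X : Type*} [Fintype U] [Fintype X] (u : U → X) (hU : 0 < Fintype.card U) :
    ∑ x, empirical u x = 1 := by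
  have h := sum_comp_eq_card_mul_sum_empirical u (fun _ => (1 : ℝ)) hU
  have hU' : (Fintype.card U : ℝ) ≠ 0 := by exact_mod_cast hU.ne'
  simp only [Finset.sum_const, Finset.card_univ, nsmul_eq_mul, mul_one] at h
  field_simp at h
  exact h.symm

/-- Convergence is known only for patterns that occur in the tree, which bounds each type frequency
from below in the limit. Since both families sum to one, these lower bounds for all other types give
the matching upper bound. -/
lemma BenjaminiSchrammConverges.tendsto_empirical {T : SimpleGraph V} [T.LocallyFinite]
    (hT : T.IsTree) {d : ℕ} (hd : 2 ≤ d) (hreg : T.IsRegularOfDegree d) {n : ℕ → ℕ}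
    {G : ∀ i, SimpleGraph (Fin (n i))} {f : ∀ i, Fin (n i) → S} {μ : Measure (V → S)}
    [IsProbabilityMeasure μ] (h : BenjaminiSchrammConverges T G f μ) (o : V) (x : VertexType S d) :
    Tendsto (fun i => empirical (vertexType d (G i) (f i)) x) atTop (𝓝 (typeLaw T d μ o x)) := by
  have hn := h.tendsto_atTop hT hd hreg
  have hm : ∀ x : VertexType S d, ∃ m : ℕ → ℝ, Tendsto m atTop (𝓝 (typeLaw T d μ o x)) ∧
      ∀ i, m i ≤ empirical (vertexType d (G i) (f i)) x := by
    intro x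
    by_cases hx : ∃ c : V → S, vertexType d T c o = x
    · obtain ⟨c, rfl⟩ := hx
      refine ⟨fun i => ({v | SameColoredBall 1 (G i) v (f i) T o c}.ncard : ℝ) / n i, ?_,
        fun i => ?_⟩
      rotate_left
      · rw [empirical, Fintype.card_fin, ← Set.ncard_coe_finset]
        refine div_le_div_of_nonneg_right (Nat.cast_le.2 ?_) (Nat.cast_nonneg _)
        refine Set.ncard_le_ncard (fun v hv => ?_) (Set.toFinite _)
        simpa using SameColoredBall.vertexType_eq hv
      · have hset : {ω | SameColoredBall 1 T o ω T o c} =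
            {ω | vertexType d T ω o = vertexType d T c o} := by
          ext ω
          exact ⟨fun h => h.vertexType_eq, sameColoredBall_one_of_vertexType_eq hT hreg⟩
        rw [typeLaw, ← hset]
        exact h o 1 c
    · refine ⟨fun _ => 0, ?_, fun i => ?_⟩
      · have : {ω : V → S | vertexType d T ω o = x} = ∅ :=
          Set.eq_empty_iff_forall_notMem.2 fun ω hω => hx ⟨ω, hω⟩
        rw [typeLaw, this, measureReal_empty]
        exact tendsto_const_nhds
      · unfold empirical
        positivity
  choose m hm1 hm2 using hm
  have hup : Tendsto (fun i => 1 - ∑ y ∈ Finset.univ.erase x, m y i) atTop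
      (𝓝 (typeLaw T d μ o x)) := by
    have h1 := (tendsto_finsetSum (Finset.univ.erase x) fun y _ => hm1 y).const_sub 1
    have h2 := Finset.add_sum_erase Finset.univ (typeLaw T d μ o) (Finset.mem_univ x)
    rw [sum_typeLaw] at h2
    rwa [show 1 - ∑ y ∈ Finset.univ.erase x, typeLaw T d μ o y = typeLaw T d μ o x by linarith]
      at h1
  refine tendsto_of_tendsto_of_tendsto_of_le_of_le' (hm1 x) hup
    (Eventually.of_forall fun i => hm2 x i) ?_
  filter_upwards [hn.eventually_gt_atTop 0] with i hi
  have h1 := sum_empirical (vertexType d (G i) (f i)) (by simpa using hi)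
  rw [← Finset.add_sum_erase Finset.univ _ (Finset.mem_univ x)] at h1
  have h2 := Finset.sum_le_sum fun y (_ : y ∈ Finset.univ.erase x) => hm2 y i
  linarith

end LocalLimits

/-! ### Gibbs' inequality and the case of equality on a star -/

section Gibbs

open scoped Classical

open Real

/-- This is log x ≤ x - 1 at x = q/p, which is strict unless x = 1. -/
lemma sub_le_gibbs_term {p q : ℝ} (hp : 0 ≤ p) (hq : 0 ≤ q) (h : q = 0 → p = 0) :
    p - q ≤ -(p * log q) - negMulLog p ∧ (p - q = -(p * log q) - negMulLog p → p = q) := by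
  rcases hp.eq_or_lt with rfl | hp
  · simp only [zero_mul, negMulLog_zero]
    exact ⟨by linarith, fun h => by linarith⟩
  · have hq : 0 < q := hq.lt_of_ne fun h0 => hp.ne' (h h0.symm)
    have e : -(p * log q) - negMulLog p = -(p * log (q / p)) := by
      rw [negMulLog, log_div hq.ne' hp.ne']
      ring
    rw [e]
    constructor
    · have := mul_le_mul_of_nonneg_left (log_le_sub_one_of_pos (div_pos hq hp)) hp.le
      rw [mul_sub, mul_div_cancel₀ _ hp.ne'] at this
      linarith
    · intro h
      by_contra hne
      have h1 : q / p ≠ 1 := fun h1 => hne ((div_eq_one_iff_eq hp.ne').1 h1).symm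
      have := mul_lt_mul_of_pos_left (log_lt_sub_one_of_pos (div_pos hq hp) h1) hp
      rw [mul_sub, mul_div_cancel₀ _ hp.ne'] at this
      linarith

/-- Gibbs' inequality, with the case of equality. -/
lemma gibbs_inequality {ι : Type*} [Fintype ι] {P q : ι → ℝ} (hP : ∀ i, 0 ≤ P i)
    (hq : ∀ i, 0 ≤ q i) (hP1 : ∑ i, P i = 1) (hq1 : ∑ i, q i ≤ 1) (h : ∀ i, q i = 0 → P i = 0) :
    ∑ i, negMulLog (P i) ≤ ∑ i, -(P i * log (q i)) ∧
      (∑ i, -(P i * log (q i)) ≤ ∑ i, negMulLog (P i) → P = q) := by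
  have hterm := fun i => sub_le_gibbs_term (hP i) (hq i) (h i)
  have hsum := Finset.sum_le_sum fun i (_ : i ∈ Finset.univ) => (hterm i).1
  simp only [Finset.sum_sub_distrib] at hsum
  refine ⟨by linarith, fun hle => ?_⟩
  have heq : ∑ i, (P i - q i) = ∑ i, (-(P i * log (q i)) - negMulLog (P i)) := by
    simp only [Finset.sum_sub_distrib]
    linarith
  have := (Finset.sum_eq_sum_iff_of_le fun i _ => (hterm i).1).1 heq
  funext i
  exact (hterm i).2 (this i (Finset.mem_univ i))

variable {J S : Type*} [Fintype J] [Fintype S]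

lemma sum_mul_comp_eq {Y Z : Type*} [Fintype Y] [Fintype Z] [DecidableEq Z] (P : Y → ℝ)
    (g : Y → Z) (L : Z → ℝ) (hL : ∀ z, ∑ y with g y = z, P y = L z) (h : Z → ℝ) :
    ∑ y, P y * h (g y) = ∑ z, L z * h z := by
  rw [← Finset.sum_fiberwise (s := Finset.univ) (g := g)]
  refine Finset.sum_congr rfl fun z _ => ?_
  rw [← hL, Finset.sum_mul]
  refine Finset.sum_congr rfl fun y hy => ?_
  rw [(Finset.mem_filter.1 hy).2]

/-- A law on colorings of a star with one leaf removed whose entropy is at least `d / 2` times the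
entropy of an edge is a product measure. -/
lemma eq_prod_of_entropy_ge [DecidableEq J] {d : ℕ} (hd : 3 ≤ d) (hJ : Fintype.card J = d) (o : J)
    {P : (J → S) → ℝ} (hP : ∀ y, 0 ≤ P y) (hP1 : ∑ y, P y = 1) {p : S → ℝ} {p₂ : S × S → ℝ}
    (hp : ∀ j s, ∑ y with y j = s, P y = p s)
    (hp₂ : ∀ j, j ≠ o → ∀ q, ∑ y with (y o, y j) = q, P y = p₂ q)
    (hH : d / 2 * ∑ q, negMulLog (p₂ q) ≤ ∑ y, negMulLog (P y)) (y : J → S) :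
    P y = ∏ j, p (y j) := by
  have hp0 : ∀ s, 0 ≤ p s := fun s => by
    rw [← hp o]; exact Finset.sum_nonneg fun y _ => hP y
  have hpsum : ∑ s, p s = 1 := by
    have := sum_mul_comp_eq P (fun y => y o) p (hp o) fun _ => 1
    simpa [hP1] using this.symm
  obtain ⟨j₀, hj₀⟩ : ∃ j, j ≠ o := by
    have : 1 < Fintype.card J := by omega
    have := Fintype.one_lt_card_iff_nontrivial.1 this
    exact exists_ne o
  have hp₂0 : ∀ q, 0 ≤ p₂ q := fun q => by
    rw [← hp₂ j₀ hj₀]; exact Finset.sum_nonneg fun y _ => hP y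
  have hp₂sum : ∑ q, p₂ q = 1 := by
    have := sum_mul_comp_eq P (fun y => (y o, y j₀)) p₂ (hp₂ j₀ hj₀) fun _ => 1
    simpa [hP1] using this.symm
  have hfst : ∀ h : S → ℝ, ∑ q, p₂ q * h q.1 = ∑ s, p s * h s := fun h => by
    rw [← sum_mul_comp_eq P (fun y => (y o, y j₀)) p₂ (hp₂ j₀ hj₀) fun q => h q.1,
      ← sum_mul_comp_eq P (fun y => y o) p (hp o) h]
  have hsnd : ∀ h : S → ℝ, ∑ q, p₂ q * h q.2 = ∑ s, p s * h s := fun h => by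
    rw [← sum_mul_comp_eq P (fun y => (y o, y j₀)) p₂ (hp₂ j₀ hj₀) fun q => h q.2,
      ← sum_mul_comp_eq P (fun y => y j₀) p (hp j₀) h]
  have hmarg : ∀ a, ∑ b, p₂ (a, b) = p a := by
    intro a
    have := hfst fun s => if s = a then 1 else 0
    rw [Fintype.sum_prod_type, Finset.sum_comm] at this
    simpa using this
  have hp_of : ∀ y j, 0 < P y → 0 < p (y j) := by
    intro y j hy
    rw [← hp j]
    exact hy.trans_le (Finset.single_le_sum (f := P) (fun y _ => hP y) (by simp))
  have hp₂_of : ∀ y j, j ≠ o → 0 < P y → 0 < p₂ (y o, y j) := by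
    intro y j hj hy
    rw [← hp₂ j hj]
    exact hy.trans_le (Finset.single_le_sum (f := P) (fun y _ => hP y) (by simp))
  have hp₂_zero : ∀ q : S × S, p q.1 * p q.2 = 0 → p₂ q = 0 := by
    intro q hq
    by_contra hne
    have hpos : 0 < p₂ q := (hp₂0 q).lt_of_ne (Ne.symm hne)
    rw [← hp₂ j₀ hj₀ q] at hpos
    obtain ⟨y, hy, hPy⟩ := Finset.exists_lt_of_sum_lt (f := fun _ => (0 : ℝ)) (by simpa using hpos)
    rw [Finset.mem_filter] at hy
    have := mul_pos (hp_of y o hPy) (hp_of y j₀ hPy)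
    rw [← hy.2] at hq
    exact this.ne' hq
  set hv : ℝ := ∑ s, negMulLog (p s) with hhv
  set he : ℝ := ∑ q, negMulLog (p₂ q) with hhe
  have hvsum : ∑ s, p s * log (p s) = -hv := by
    rw [hhv, ← Finset.sum_neg_distrib]
    exact Finset.sum_congr rfl fun s _ => by rw [negMulLog]; ring
  have hesum : ∑ q, p₂ q * log (p₂ q) = -he := by
    rw [hhe, ← Finset.sum_neg_distrib]
    exact Finset.sum_congr rfl fun s _ => by rw [negMulLog]; ring
  have hPv : ∀ j, ∑ y, P y * log (p (y j)) = -hv := fun j => by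
    rw [sum_mul_comp_eq P (fun y => y j) p (hp j) fun s => log (p s), hvsum]
  have hPe : ∀ j, j ≠ o → ∑ y, P y * log (p₂ (y o, y j)) = -he := fun j hj => by
    rw [sum_mul_comp_eq P (fun y => (y o, y j)) p₂ (hp₂ j hj) fun q => log (p₂ q), hesum]
  -- the entropy of an edge is at most twice the entropy of a vertex
  have hC : he ≤ 2 * hv := by
    have := (gibbs_inequality (P := p₂) (q := fun q => p q.1 * p q.2) hp₂0
      (fun q => mul_nonneg (hp0 _) (hp0 _)) hp₂sum (by
        rw [Fintype.sum_prod_type]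
        simp only [← Finset.mul_sum, hpsum, mul_one]
        exact le_rfl) hp₂_zero).1
    refine this.trans (le_of_eq ?_)
    have e : ∀ q : S × S, -(p₂ q * log (p q.1 * p q.2)) =
        -(p₂ q * log (p q.1)) - p₂ q * log (p q.2) := by
      intro q
      by_cases h0 : p q.1 * p q.2 = 0
      · simp [hp₂_zero q h0]
      · rw [log_mul (left_ne_zero_of_mul h0) (right_ne_zero_of_mul h0)]
        ring
    rw [Finset.sum_congr rfl fun q _ => e q, Finset.sum_sub_distrib, Finset.sum_neg_distrib,
      hfst fun s => log (p s), hsnd fun s => log (p s), hvsum]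
    ring
  have hcardJ : ((Finset.univ.erase o).card : ℝ) = d - 1 := by
    rw [Finset.card_erase_of_mem (Finset.mem_univ o), Finset.card_univ, hJ]
    push_cast [show 1 ≤ d by omega]
    ring
  -- the entropy of the star is at most that of independent leaves given the center
  have hB : ∑ y, negMulLog (P y) ≤ hv + (d - 1) * (he - hv) := by
    -- The comparison law has the true edge marginals and leaves independent given the center. For
    -- fixed center color `a` it is a product of the factors `t a j`, the one at `o` being `p a`
    -- times a point mass at `a`.
    set t : S → J → S → ℝ := fun a j s =>
      if j = o then (if s = a then p a else 0) else p₂ (a, s) / p a with ht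
    have ht0 : ∀ a j s, 0 ≤ t a j s := by
      intro a j s
      simp only [ht]
      split_ifs
      · exact hp0 a
      · exact le_rfl
      · exact div_nonneg (hp₂0 _) (hp0 _)
    set q : (J → S) → ℝ := fun y => ∏ j, t (y o) j (y j) with hq
    have hqeq : ∀ y, q y = p (y o) * ∏ j ∈ Finset.univ.erase o, (p₂ (y o, y j) / p (y o)) := by
      intro y
      simp only [hq]
      rw [← Finset.mul_prod_erase _ _ (Finset.mem_univ o)]
      congr 1
      · simp [ht]
      · refine Finset.prod_congr rfl fun j hj => ?_
        simp [ht, Finset.ne_of_mem_erase hj]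
    -- Summing over an independent `a` instead of `a = y o` lets the sum factor. Only `≤` is
    -- claimed, because colors with `p a = 0` have leaf factors 0/0 = 0.
    have hqsum : ∑ y, q y ≤ 1 := by
      have h1 : ∑ y, q y ≤ ∑ a, ∑ y : J → S, ∏ j, t a j (y j) := by
        rw [Finset.sum_comm]
        refine Finset.sum_le_sum fun y _ => ?_
        exact Finset.single_le_sum (f := fun a => ∏ j, t a j (y j))
          (fun a _ => Finset.prod_nonneg fun j _ => ht0 a j _) (Finset.mem_univ (y o))
      refine h1.trans ?_
      rw [← hpsum]
      refine Finset.sum_le_sum fun a _ => ?_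
      have h2 := Finset.prod_univ_sum (fun _ : J => (Finset.univ : Finset S)) (t a)
      rw [Fintype.piFinset_univ] at h2
      rw [← h2, ← Finset.mul_prod_erase _ _ (Finset.mem_univ o)]
      have h3 : ∑ s, t a o s = p a := by simp [ht]
      rw [h3]
      refine mul_le_of_le_one_right (hp0 a) (Finset.prod_le_one
        (fun j _ => Finset.sum_nonneg fun s _ => ht0 a j s) fun j hj => ?_)
      simp only [ht, Finset.ne_of_mem_erase hj, if_false, ← Finset.sum_div, hmarg]
      exact div_self_le_one _
    have hq_pos : ∀ y, 0 < P y → 0 < q y := by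
      intro y hy
      rw [hqeq]
      exact mul_pos (hp_of y o hy) (Finset.prod_pos fun j hj =>
        div_pos (hp₂_of y j (Finset.ne_of_mem_erase hj) hy) (hp_of y o hy))
    have hG := (gibbs_inequality (P := P) (q := q) hP
      (fun y => Finset.prod_nonneg fun j _ => ht0 _ j _) hP1 hqsum (fun y h0 => by
        by_contra hne
        exact (hq_pos y ((hP y).lt_of_ne (Ne.symm hne))).ne' h0)).1
    refine hG.trans (le_of_eq ?_)
    have e : ∀ y, -(P y * log (q y)) = -(P y * log (p (y o))) -
        ∑ j ∈ Finset.univ.erase o, (P y * log (p₂ (y o, y j)) - P y * log (p (y o))) := by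
      intro y
      rcases (hP y).eq_or_lt with h0 | hy
      · simp [← h0]
      · rw [hqeq, log_mul (hp_of y o hy).ne' (Finset.prod_pos fun j hj =>
          div_pos (hp₂_of y j (Finset.ne_of_mem_erase hj) hy) (hp_of y o hy)).ne',
          log_prod fun j hj =>
          (div_pos (hp₂_of y j (Finset.ne_of_mem_erase hj) hy) (hp_of y o hy)).ne', mul_add,
          neg_add, Finset.mul_sum, ← sub_eq_add_neg]
        congr 1
        refine Finset.sum_congr rfl fun j hj => ?_
        rw [log_div (hp₂_of y j (Finset.ne_of_mem_erase hj) hy).ne' (hp_of y o hy).ne']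
        ring
    rw [Finset.sum_congr rfl fun y _ => e y, Finset.sum_sub_distrib, Finset.sum_neg_distrib, hPv,
      Finset.sum_comm, Finset.sum_congr rfl (g := fun _ => -he + hv), Finset.sum_const,
      nsmul_eq_mul, hcardJ]
    · ring
    · intro j hj
      rw [Finset.sum_sub_distrib, hPv, hPe j (Finset.ne_of_mem_erase hj)]
      ring
  have hd' : (3 : ℝ) ≤ d := by exact_mod_cast hd
  -- `hH` and `hB` combine to (d/2 - 1)(he - 2 hv) ≥ 0, and the first factor is positive.
  have hhe2 : 2 * hv ≤ he := by nlinarith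
  have hlow : d * hv ≤ ∑ y, negMulLog (P y) := by nlinarith
  -- the case of equality
  have hprod_pos : ∀ y, 0 < P y → 0 < ∏ j, p (y j) := fun y hy =>
    Finset.prod_pos fun j _ => hp_of y j hy
  have hG := (gibbs_inequality (P := P) (q := fun y => ∏ j, p (y j)) hP
    (fun y => Finset.prod_nonneg fun j _ => hp0 _) hP1 (by
      have h2 := Finset.prod_univ_sum (fun _ : J => (Finset.univ : Finset S)) fun _ => p
      rw [Fintype.piFinset_univ] at h2
      rw [← h2, hpsum]
      simp) (fun y h0 => by
        by_contra hne
        exact (hprod_pos y ((hP y).lt_of_ne (Ne.symm hne))).ne' h0)).2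
  refine congrFun (hG (le_trans (le_of_eq ?_) hlow)) y
  have e : ∀ y, -(P y * log (∏ j, p (y j))) = -∑ j, P y * log (p (y j)) := by
    intro y
    rcases (hP y).eq_or_lt with h0 | hy
    · simp [← h0]
    · rw [log_prod fun j _ => (hp_of y j hy).ne', Finset.mul_sum]
  rw [Finset.sum_congr rfl fun y _ => e y, Finset.sum_neg_distrib, Finset.sum_comm,
    Finset.sum_congr rfl fun j _ => hPv j, Finset.sum_const, Finset.card_univ, hJ, nsmul_eq_mul]
  ring

end Gibbs

/-! ### The entropy inequality for typical processes -/

section TypicalEntropy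

open scoped Classical Nat
open SimpleGraph

variable {V S : Type*} [Fintype S] [MeasurableSpace S] [MeasurableSingletonClass S]

/-- The growth rate at the type law of a typical process is nonnegative. -/
lemma IsTypical.growthRate_nonneg {T : SimpleGraph V} [T.LocallyFinite] (hT : T.IsTree) {d : ℕ}
    (hd : 2 ≤ d) (hreg : T.IsRegularOfDegree d) {μ : Measure (V → S)} [IsProbabilityMeasure μ]
    (h : IsTypical T d μ) (o : V) (r : VertexType S d → ℝ) (hr : ∀ x, 0 < r x)
    (hr1 : ∑ x, r x ≤ 1) : 0 ≤ growthRate r (typeLaw T d μ o) := by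
  by_contra hneg
  push Not at hneg
  obtain ⟨η, hη, hle⟩ := exists_uniformOn_regularGraphs_le_half (by omega) _ r hr hr1 hneg
  obtain ⟨n, hne, hprof⟩ := h
  have hprob : ∀ i, IsProbabilityMeasure (uniformOn (regularGraphs d (n i))) := fun i =>
    isProbabilityMeasure_uniformOn (Set.toFinite _) (hne i)
  -- A single sample with a convergent coloring already forces the deterministic sizes `n i` to
  -- infinity.
  obtain ⟨G₀, -, -, f₀, hf₀⟩ := hprof.exists
  have hn := hf₀.tendsto_atTop hT hd hreg
  have hbad := ae_not_eventually_of_le_half (fun i => uniformOn (regularGraphs d (n i)))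
    (fun i => {G | ∃ f : Fin (n i) → S, ∀ x,
        |empirical (vertexType d G f) x - typeLaw T d μ o x| < η})
    (fun i => (Set.toFinite _).measurableSet)
    ((hn.eventually hle).mono fun i hi => hi (hne i))
  obtain ⟨G, ⟨-, -, f, hf⟩, hG⟩ := (hprof.and hbad).exists
  apply hG
  have hall : ∀ x, ∀ᶠ i in atTop,
      |empirical (vertexType d (G i) (f i)) x - typeLaw T d μ o x| < η := fun x => by
    simpa [Real.dist_eq] using
      (hf.tendsto_empirical hT hd hreg o x).eventually (Metric.ball_mem_nhds _ hη)
  filter_upwards [eventually_all.2 hall] with i hi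
  exact ⟨f i, hi⟩

/-- The star-edge entropy inequality for typical processes, in terms of vertex types. -/
lemma IsTypical.edge_entropy_le {T : SimpleGraph V} [T.LocallyFinite] (hT : T.IsTree) {d : ℕ}
    (hd : 2 ≤ d) (hreg : T.IsRegularOfDegree d) {μ : Measure (V → S)} [IsProbabilityMeasure μ]
    (h : IsTypical T d μ) (o : V) :
    d / 2 * ∑ p, Real.negMulLog (edgeLaw (typeLaw T d μ o) p) ≤
      ∑ x, (typeLaw T d μ o x * Real.log x.orderings + Real.negMulLog (typeLaw T d μ o x)) := by
  set P := typeLaw T d μ o with hP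
  have hP0 : ∀ x, 0 ≤ P x := fun x => measureReal_nonneg
  have hP1 : ∑ x, P x = 1 := sum_typeLaw T d μ o
  have hX : 0 < Fintype.card (VertexType S d) := by
    rw [Fintype.card_pos_iff]
    by_contra hne
    rw [not_nonempty_iff] at hne
    simp at hP1
  have hX' : (0 : ℝ) < Fintype.card (VertexType S d) := by exact_mod_cast hX
  set Z : ℝ := ∑ x, (P x * Real.log x.orderings + Real.negMulLog (P x)) -
    d / 2 * ∑ p, Real.negMulLog (edgeLaw P p) with hZ
  suffices 0 ≤ Z by linarith
  by_contra hneg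
  push Not at hneg
  set e : ℝ := Real.exp (Z / 2) with he
  have he0 : 0 < e := Real.exp_pos _
  have he1 : e < 1 := by rw [he, Real.exp_lt_one_iff]; linarith
  -- The choice `r = P` would give exactly the rate `Z`, but `r` must be positive everywhere. Mixing
  -- in a little of the uniform law costs at most `-Z / 2`, so the rate remains at most `Z / 2 < 0`.
  set r : VertexType S d → ℝ := fun x => e * P x + (1 - e) / Fintype.card (VertexType S d) with hr
  have hrpos : ∀ x, 0 < r x := fun x => by
    have := mul_nonneg he0.le (hP0 x)
    have : 0 < (1 - e) / Fintype.card (VertexType S d) := div_pos (by linarith) hX'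
    simp only [hr]
    linarith
  have hrsum : ∑ x, r x ≤ 1 := by
    simp only [hr, Finset.sum_add_distrib, ← Finset.mul_sum, hP1, Finset.sum_const,
      Finset.card_univ, nsmul_eq_mul]
    rw [mul_div_cancel₀ _ hX'.ne']
    linarith
  have hgr := h.growthRate_nonneg hT hd hreg o r hrpos hrsum
  rw [growthRate, ← hP] at hgr
  have hterm : ∀ x, P x * (Real.log x.orderings - Real.log (r x)) ≤
      P x * Real.log x.orderings + Real.negMulLog (P x) - P x * (Z / 2) := by
    intro x
    rcases (hP0 x).eq_or_lt with h0 | hx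
    · simp [← h0]
    · have h1 : Real.log e + Real.log (P x) ≤ Real.log (r x) := by
        rw [← Real.log_mul he0.ne' hx.ne']
        refine Real.log_le_log (mul_pos he0 hx) ?_
        have : 0 < (1 - e) / Fintype.card (VertexType S d) := div_pos (by linarith) hX'
        simp only [hr]
        linarith
      rw [he, Real.log_exp] at h1
      rw [Real.negMulLog]
      nlinarith
  have hsum := Finset.sum_le_sum fun x (_ : x ∈ Finset.univ) => hterm x
  rw [Finset.sum_sub_distrib, ← Finset.sum_mul, hP1] at hsum
  linarith

end TypicalEntropy

/-! ### From unordered vertex types to ordered stars -/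

section Orderings

open scoped Classical Nat

variable {N S : Type*} [Fintype N]

lemma exists_perm_comp_eq {f g : N → S}
    (h : ∀ b, Finset.card {w | f w = b} = Finset.card {w | g w = b}) :
    ∃ σ : Equiv.Perm N, g ∘ σ = f := by
  have hfib : ∀ b : S, Nonempty ({w // f w = b} ≃ {w // g w = b}) := by
    intro b
    rw [← Fintype.card_eq, Fintype.card_subtype, Fintype.card_subtype, h]
  exact ⟨Equiv.ofFiberEquiv (f := f) (g := g) fun b => (hfib b).some,
    funext (Equiv.ofFiberEquiv_map (f := f) (g := g) fun b => (hfib b).some)⟩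

/-- The number of rearrangements of a word is a multinomial coefficient. -/
lemma card_rearrangements_mul_prod_factorial [DecidableEq N] [Fintype S] (g : N → S) :
    Finset.card {g' : N → S | ∀ b, Finset.card {w | g' w = b} = Finset.card {w | g w = b}} *
      ∏ b, (Finset.card {w | g w = b})! = (Fintype.card N)! := by
  set K : Finset (N → S) :=
    {g' : N → S | ∀ b, Finset.card {w | g' w = b} = Finset.card {w | g w = b}} with hK
  have hmaps : ∀ σ ∈ (Finset.univ : Finset (Equiv.Perm N)), g ∘ σ ∈ K := by
    intro σ _
    simp only [hK, Finset.mem_filter, Finset.mem_univ, true_and]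
    intro b
    refine Finset.card_bij (fun w _ => σ w) ?_ ?_ ?_
    · intro w hw; simpa using hw
    · intro w _ w' _ h; exact σ.injective h
    · intro w hw
      exact ⟨σ.symm w, by simpa using hw, by simp⟩
  -- Orbit counting: the permutations producing `g'` form a coset of the stabilizer of `g`, which
  -- permutes each color class separately.
  have hfiber : ∀ g' ∈ K, Finset.card {σ : Equiv.Perm N | g ∘ σ = g'} =
      ∏ b, (Finset.card {w | g w = b})! := by
    intro g' hg'
    simp only [hK, Finset.mem_filter, Finset.mem_univ, true_and] at hg'
    obtain ⟨σ₀, hσ₀⟩ := exists_perm_comp_eq hg'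
    have h1 : Finset.card {σ : Equiv.Perm N | g ∘ σ = g'} =
        Finset.card {σ : Equiv.Perm N | g ∘ σ = g} := by
      symm
      refine Finset.card_bij (fun σ _ => σ₀.trans σ) ?_ ?_ ?_
      · intro σ hσ
        simp only [Finset.mem_filter, Finset.mem_univ, true_and] at hσ ⊢
        rw [Equiv.coe_trans, ← Function.comp_assoc, hσ, hσ₀]
      · intro σ _ τ _ h
        ext w
        simpa using DFunLike.congr_fun h (σ₀.symm w)
      · intro σ hσ
        simp only [Finset.mem_filter, Finset.mem_univ, true_and] at hσ
        refine ⟨σ₀.symm.trans σ, ?_, by ext; simp⟩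
        simp only [Finset.mem_filter, Finset.mem_univ, true_and]
        rw [Equiv.coe_trans, ← Function.comp_assoc, hσ, ← hσ₀, Function.comp_assoc,
          Equiv.self_comp_symm, Function.comp_id]
    rw [h1, ← Fintype.card_subtype, DomMulAct.stabilizer_card]
    exact Finset.prod_congr rfl fun b _ => by rw [Fintype.card_subtype]
  have h := Finset.card_eq_sum_card_fiberwise hmaps
  rw [Finset.card_univ, Fintype.card_perm, Finset.sum_congr rfl hfiber, Finset.sum_const,
    smul_eq_mul] at h
  exact h.symm

/-- The vertex type of a star with ordered leaves. -/
noncomputable def starType (d : ℕ) (x : S × (N → S)) : VertexType S d :=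
  (x.1, fun b => Fin.ofNat (d + 1) (Finset.card {w | x.2 w = b}))

/-- A star with `d` leaves has color counts at most `d`, so the reduction modulo `d + 1` loses
nothing. -/
lemma starType_eq_iff {d : ℕ} (hN : Fintype.card N = d) {x y : S × (N → S)} :
    starType d x = starType d y ↔
      x.1 = y.1 ∧ ∀ b, Finset.card {w | x.2 w = b} = Finset.card {w | y.2 w = b} := by
  have hlt : ∀ (g : N → S) (b : S), Finset.card {w | g w = b} < d + 1 := fun g b => by
    rw [← hN]
    exact Nat.lt_succ_of_le (Finset.card_le_univ _)
  rw [starType, starType, Prod.mk.injEq, funext_iff]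
  refine and_congr_right fun _ => forall_congr' fun b => ?_
  rw [Fin.ext_iff, Fin.val_ofNat, Fin.val_ofNat, Nat.mod_eq_of_lt (hlt _ _),
    Nat.mod_eq_of_lt (hlt _ _)]

lemma coe_starType_snd {d : ℕ} (hN : Fintype.card N = d) (x : S × (N → S)) (b : S) :
    ((starType d x).2 b : ℕ) = Finset.card {w | x.2 w = b} := by
  have : Finset.card {w | x.2 w = b} < d + 1 := by
    rw [← hN]
    exact Nat.lt_succ_of_le (Finset.card_le_univ _)
  rw [starType, Fin.val_ofNat, Nat.mod_eq_of_lt this]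

/-- The entropy of an exchangeable law on ordered stars in terms of the law of the type. -/
lemma sum_negMulLog_eq_of_exchangeable [DecidableEq N] [Fintype S] {d : ℕ}
    (hN : Fintype.card N = d) (L : S × (N → S) → ℝ)
    (hL : ∀ (σ : Equiv.Perm N) a g, L (a, g ∘ σ) = L (a, g))
    (P : VertexType S d → ℝ) (hP : ∀ x, ∑ y with starType d y = x, L y = P x) :
    ∑ y, Real.negMulLog (L y) =
      ∑ x, (P x * Real.log x.orderings + Real.negMulLog (P x)) := by
  rw [← Finset.sum_fiberwise (s := Finset.univ) (g := starType d)]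
  refine Finset.sum_congr rfl fun x _ => ?_
  by_cases hx : ∃ y : S × (N → S), starType d y = x
  swap
  · have : Finset.filter (fun y : S × (N → S) => starType d y = x) Finset.univ = ∅ :=
      Finset.filter_eq_empty_iff.2 fun y _ hy => hx ⟨y, hy⟩
    rw [← hP, this]
    simp
  obtain ⟨⟨a, g⟩, rfl⟩ := hx
  have hconst : ∀ y ∈ Finset.filter (fun y : S × (N → S) => starType d y = starType d (a, g))
      Finset.univ, L y = L (a, g) := by
    rintro ⟨a', g'⟩ hy
    rw [Finset.mem_filter, starType_eq_iff hN] at hy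
    obtain ⟨-, ha, hg⟩ := hy
    obtain ⟨σ, hσ⟩ := exists_perm_comp_eq hg
    simp only at ha hσ
    rw [← hσ, hL, ha]
  set k := (Finset.filter (fun y : S × (N → S) => starType d y = starType d (a, g))
      Finset.univ).card with hk
  have hk' : k = Finset.card {g' : N → S |
      ∀ b, Finset.card {w | g' w = b} = Finset.card {w | g w = b}} := by
    refine Finset.card_bij (fun y _ => y.2) ?_ ?_ ?_
    · intro y hy
      rw [Finset.mem_filter, starType_eq_iff hN] at hy
      simpa using hy.2.2
    · intro y hy y' hy' h
      rw [Finset.mem_filter, starType_eq_iff hN] at hy hy'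
      exact Prod.ext (hy.2.1.trans hy'.2.1.symm) h
    · intro g' hg'
      refine ⟨(a, g'), ?_, rfl⟩
      rw [Finset.mem_filter, starType_eq_iff hN]
      exact ⟨Finset.mem_univ _, rfl, by simpa using hg'⟩
  -- The law is uniform on the fiber over a type, so the fiber contributes the entropy term of the
  -- type plus its probability times the logarithm of the fiber size.
  have hkord : (k : ℝ) = (starType d (a, g)).orderings := by
    have h1 := card_rearrangements_mul_prod_factorial g
    rw [← hk', hN] at h1
    rw [VertexType.orderings, eq_div_iff (by positivity)]
    simp only [coe_starType_snd hN]
    exact_mod_cast h1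
  have hk0 : (k : ℝ) ≠ 0 := by
    rw [hkord]
    exact (VertexType.orderings_pos _).ne'
  rw [← hP, Finset.sum_congr rfl fun y hy => by rw [hconst y hy], Finset.sum_const,
    Finset.sum_congr rfl hconst, Finset.sum_const, ← hk, ← hkord, nsmul_eq_mul, nsmul_eq_mul]
  by_cases h0 : L (a, g) = 0
  · simp [h0]
  · rw [Real.negMulLog, Real.negMulLog, Real.log_mul hk0 h0]
    ring

end Orderings

/-! ### Laws and entropies of finite-valued random variables -/

section FiniteLaws

open scoped Classical

lemma sum_measureReal_fiber {Ω Y Z : Type*} [MeasurableSpace Ω] (μ : Measure Ω) [IsFiniteMeasure μ]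
    [Fintype Y] [DecidableEq Z] (g : Ω → Y) (hg : ∀ y, MeasurableSet {ω | g ω = y}) (h : Y → Z)
    (z : Z) : ∑ y with h y = z, μ.real {ω | g ω = y} = μ.real {ω | h (g ω) = z} := by
  have := sum_measureReal_preimage_singleton (μ := μ) (f := g) {y | h y = z} fun y _ => hg y
  refine this.trans ?_
  congr 1
  ext ω
  simp

/-- A random variable that is almost surely an injective function of another one has the same
entropy. -/
lemma sum_negMulLog_eq_of_ae_eq {Ω Y Z : Type*} [MeasurableSpace Ω] (μ : Measure Ω)
    [Fintype Y] [Fintype Z] (g : Ω → Y) (g' : Ω → Z) (h : Y → Z) (hh : Function.Injective h)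
    (hae : ∀ᵐ ω ∂μ, g' ω = h (g ω)) :
    ∑ z, Real.negMulLog (μ.real {ω | g' ω = z}) = ∑ y, Real.negMulLog (μ.real {ω | g ω = y}) := by
  have h1 : ∀ z, μ.real {ω | g' ω = z} = μ.real {ω | h (g ω) = z} := fun z => by
    refine measureReal_congr ?_
    filter_upwards [hae] with ω hω
    exact propext (show g' ω = z ↔ h (g ω) = z by rw [hω])
  have h2 : ∀ y, μ.real {ω | g ω = y} = μ.real {ω | h (g ω) = h y} := fun y => by
    simp only [hh.eq_iff]
  simp only [h1, h2]
  rw [← Finset.sum_image (f := fun z => Real.negMulLog (μ.real {ω | h (g ω) = z})) (g := h)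
    hh.injOn]
  symm
  refine Finset.sum_subset (Finset.subset_univ _) fun z _ hz => ?_
  have : {ω | h (g ω) = z} = ∅ := Set.eq_empty_iff_forall_notMem.2 fun ω hω =>
    hz (Finset.mem_image.2 ⟨g ω, Finset.mem_univ _, hω⟩)
  rw [this, measureReal_empty, Real.negMulLog_zero]

end FiniteLaws

/-! ### Invariant processes and rigidity -/

section InvariantProcesses

open scoped Classical
open SimpleGraph

variable {V S : Type*}

lemma vertexType_eq_starType (T : SimpleGraph V) [T.LocallyFinite] (d : ℕ) (o : V) (f : V → S) :
    vertexType d T f o = starType d (f o, fun w : T.neighborSet o => f w) := by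
  have : ∀ b, colorDegree T f o b = Finset.card {w : T.neighborSet o | f w = b} := by
    intro b
    rw [colorDegree, ← Nat.card_coe_set_eq, ← Fintype.card_subtype, ← Nat.card_eq_fintype_card]
    exact (Nat.card_congr (Equiv.subtypeSubtypeEquivSubtypeInter (fun w => T.Adj o w)
        fun w => f w = b)).symm
  simp only [vertexType, starType, this]

lemma starMinusLeaf_card {T : SimpleGraph V} [T.LocallyFinite] {d : ℕ}
    (hreg : T.IsRegularOfDegree d) {o w : V} (how : T.Adj o w) :
    (starMinusLeaf T o w).Finite ∧ Nat.card (starMinusLeaf T o w) = d := by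
  have hfin : (T.neighborSet o).Finite := Set.toFinite _
  refine ⟨(hfin.insert o).subset Set.sdiff_subset, ?_⟩
  rw [Nat.card_coe_set_eq, starMinusLeaf, Set.ncard_sdiff_singleton_of_mem
    (show w ∈ insert o (T.neighborSet o) from Or.inr how),
    Set.ncard_insert_of_notMem (by simp) hfin, Nat.add_sub_cancel, Set.ncard_eq_toFinset_card',
    ← hreg o, ← card_neighborFinset_eq_degree]
  rfl

variable [MeasurableSpace S]

lemma measureReal_comp_iso {T : SimpleGraph V} {μ : Measure (V → S)}
    (hμ : μ ∈ invariantProcesses T S) (Φ : T ≃g T) {A : Set (V → S)} (hA : MeasurableSet A) :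
    μ.real {f | (fun v => f (Φ v)) ∈ A} = μ.real A := by
  have h := hμ.2 Φ.symm
  have hm : Measurable fun (f : V → S) (v : V) => f (Φ v) :=
    measurable_pi_lambda _ fun v => measurable_pi_apply _
  conv_rhs => rw [← h]
  rw [measureReal_def, measureReal_def]
  congr 1
  exact (Measure.map_apply hm hA).symm

/-- Every permutation of the leaves extends to an automorphism of the tree fixing the center, so
invariance makes the leaves exchangeable jointly with the center. -/
lemma measureReal_star_comp_perm {T : SimpleGraph V} [T.LocallyFinite] (hT : T.IsTree) {d : ℕ}
    (hreg : T.IsRegularOfDegree d) {μ : Measure (V → S)} (hμ : μ ∈ invariantProcesses T S) (o : V)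
    (σ : Equiv.Perm (T.neighborSet o)) {A : Set (S × (T.neighborSet o → S))}
    (hA : MeasurableSet A) :
    μ.real {f | (f o, fun w : T.neighborSet o => f (σ w)) ∈ A} =
      μ.real {f | (f o, fun w : T.neighborSet o => f w) ∈ A} := by
  obtain ⟨Φ, hΦo, hΦ⟩ := hT.exists_iso_extending hreg σ
  have hm : Measurable fun f : V → S => (f o, fun w : T.neighborSet o => f w) :=
    (measurable_pi_apply o).prodMk (measurable_pi_lambda _ fun w => measurable_pi_apply _)
  have := measureReal_comp_iso hμ Φ (hm hA)
  rw [Set.preimage] at this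
  rw [← this]
  simp [hΦo, hΦ]

variable [MeasurableSingletonClass S]

lemma measurableSet_apply_eq (v : V) (s : S) : MeasurableSet {f : V → S | f v = s} :=
  (show Measurable fun f : V → S => f v from measurable_pi_apply v) (measurableSet_singleton s)

lemma measureReal_apply_eq {T : SimpleGraph V} [T.LocallyFinite] (hT : T.IsTree) {d : ℕ}
    (hreg : T.IsRegularOfDegree d) {μ : Measure (V → S)} (hμ : μ ∈ invariantProcesses T S)
    (u v : V) (s : S) : μ.real {f | f u = s} = μ.real {f | f v = s} := by
  have hc : Fintype.card (T.neighborSet v) = Fintype.card (T.neighborSet u) := by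
    rw [card_neighborSet_eq_degree, card_neighborSet_eq_degree, hreg v, hreg u]
  obtain ⟨Φ, hΦ, -⟩ := hT.exists_iso_extending hreg (Fintype.equivOfCardEq hc)
  have := measureReal_comp_iso hμ Φ (measurableSet_apply_eq v s)
  rw [← this]
  simp [hΦ]

lemma measurableSet_star_eq (T : SimpleGraph V) [T.LocallyFinite] (o : V)
    (x : S × (T.neighborSet o → S)) :
    MeasurableSet {f : V → S | (f o, fun w : T.neighborSet o => f w) = x} :=
  (show Measurable fun f : V → S => (f o, fun w : T.neighborSet o => f w) from
    (measurable_pi_apply o).prodMk (measurable_pi_lambda _ fun _ => measurable_pi_apply _))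
    (measurableSet_singleton x)

variable [Fintype S]

lemma measureReal_pair_eq {T : SimpleGraph V} [T.LocallyFinite] (hT : T.IsTree) {d : ℕ}
    (hreg : T.IsRegularOfDegree d) {μ : Measure (V → S)} (hμ : μ ∈ invariantProcesses T S) (o : V)
    (w w' : T.neighborSet o) (q : S × S) :
    μ.real {f | (f o, f w) = q} = μ.real {f | (f o, f w') = q} := by
  have h := measureReal_star_comp_perm hT hreg hμ o (Equiv.swap w w')
    (A := {x | (x.1, x.2 w') = q}) (Set.toFinite _).measurableSet
  simpa using h

/-- The law of a random edge does not depend on the edge. -/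
lemma edgeLaw_typeLaw {T : SimpleGraph V} [T.LocallyFinite] (hT : T.IsTree) {d : ℕ} (hd : 0 < d)
    (hreg : T.IsRegularOfDegree d) {μ : Measure (V → S)} [IsProbabilityMeasure μ]
    (hμ : μ ∈ invariantProcesses T S) (o : V) (w₀ : T.neighborSet o) (q : S × S) :
    edgeLaw (typeLaw T d μ o) q = μ.real {f | (f o, f w₀) = q} := by
  have hN : Fintype.card (T.neighborSet o) = d := by
    rw [card_neighborSet_eq_degree, hreg o]
  set L : S × (T.neighborSet o → S) → ℝ := fun x =>
    μ.real {f | (f o, fun w : T.neighborSet o => f w) = x} with hL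
  have hfib : ∀ z, ∑ x with starType d x = z, L x = typeLaw T d μ o z := by
    intro z
    rw [sum_measureReal_fiber μ _ (measurableSet_star_eq T o), typeLaw]
    simp only [vertexType_eq_starType]
  have hpair : ∀ w : T.neighborSet o, ∑ x with (x.1, x.2 w) = q, L x =
      μ.real {f | (f o, f w₀) = q} := by
    intro w
    rw [sum_measureReal_fiber μ _ (measurableSet_star_eq T o) fun x => (x.1, x.2 w)]
    exact measureReal_pair_eq hT hreg hμ o w w₀ q
  have h1 := sum_mul_comp_eq L (starType d) (typeLaw T d μ o) hfib fun z => z.edgeCoeff q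
  rw [edgeLaw, Finset.sum_congr rfl fun x _ => mul_comm _ _, ← h1]
  -- The edge coefficient of a type is the proportion of leaves that form the pair `q` with the
  -- center; by exchangeability all leaves contribute equally.
  have h2 : ∀ x : S × (T.neighborSet o → S), L x * (starType d x).edgeCoeff q =
      (∑ w, if (x.1, x.2 w) = q then L x else 0) / d := by
    intro x
    rw [VertexType.edgeCoeff, coe_starType_snd hN]
    by_cases hx : x.1 = q.1
    · have : (starType d x).1 = q.1 := hx
      rw [if_pos this, ← Finset.sum_filter, Finset.sum_const, nsmul_eq_mul]
      simp only [Prod.ext_iff, hx, true_and]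
      ring
    · have : ¬ (starType d x).1 = q.1 := hx
      rw [if_neg this]
      simp [Prod.ext_iff, hx]
  rw [Finset.sum_congr rfl fun x _ => h2 x, ← Finset.sum_div, Finset.sum_comm]
  simp only [← Finset.sum_filter, hpair, Finset.sum_const, Finset.card_univ, hN, nsmul_eq_mul]
  have : (d : ℝ) ≠ 0 := by exact_mod_cast hd.ne'
  field_simp

/-- For a typical process, the entropy of a star is at least `d / 2` times that of an edge. -/
lemma IsTypical.edge_entropy_le_star_entropy {T : SimpleGraph V} [T.LocallyFinite] (hT : T.IsTree)
    {d : ℕ} (hd : 2 ≤ d) (hreg : T.IsRegularOfDegree d) {μ : Measure (V → S)}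
    (hμ : μ ∈ invariantProcesses T S) (h : IsTypical T d μ) (o : V) (w₀ : T.neighborSet o) :
    d / 2 * ∑ q : S × S, Real.negMulLog (μ.real {f | (f o, f w₀) = q}) ≤
      ∑ x, Real.negMulLog (μ.real {f | (f o, fun w : T.neighborSet o => f w) = x}) := by
  have := hμ.1
  have hN : Fintype.card (T.neighborSet o) = d := by
    rw [card_neighborSet_eq_degree, hreg o]
  have h1 := h.edge_entropy_le hT hd hreg o
  simp only [edgeLaw_typeLaw hT (by omega : 0 < d) hreg hμ o w₀] at h1
  refine h1.trans (le_of_eq ?_)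
  refine (sum_negMulLog_eq_of_exchangeable hN
    (fun x => μ.real {f | (f o, fun w : T.neighborSet o => f w) = x}) ?_ (typeLaw T d μ o) ?_).symm
  · intro σ a g
    have := measureReal_star_comp_perm hT hreg hμ o σ
      (A := {(a, g ∘ σ)}) (measurableSet_singleton _)
    simp only [Set.mem_singleton_iff] at this
    rw [← this]
    congr 1
    ext f
    simp only [Set.mem_ofPred_eq, Prod.mk.injEq]
    refine and_congr_right fun _ => ?_
    constructor
    · intro h
      funext w
      have := congrFun h (σ.symm w)
      simpa using this
    · intro h
      funext w
      exact congrFun h (σ w)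
  · intro z
    rw [sum_measureReal_fiber μ _ (measurableSet_star_eq T o), typeLaw]
    simp only [vertexType_eq_starType]

/-- If the labels of a star of a typical process are determined by the labels without one of the
leaves, then the latter are independent. -/
lemma IsTypical.measureReal_starMinusLeaf {T : SimpleGraph V} [T.LocallyFinite] (hT : T.IsTree)
    {d : ℕ} (hd : 3 ≤ d) (hreg : T.IsRegularOfDegree d) {μ : Measure (V → S)}
    (hμ : μ ∈ invariantProcesses T S) (h : IsTypical T d μ) {o w : V} (how : T.Adj o w)
    (F : (starMinusLeaf T o w → S) → S)
    (hF : ∀ᵐ f ∂μ, f w = F (fun v : starMinusLeaf T o w => f v))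
    [Fintype (starMinusLeaf T o w)] (y : starMinusLeaf T o w → S) :
    μ.real {f | (fun v : starMinusLeaf T o w => f v) = y} = ∏ j, μ.real {f | f o = y j} := by
  have := hμ.1
  have ho : o ∈ starMinusLeaf T o w := ⟨Or.inl rfl, how.ne⟩
  have hmeas : ∀ y : starMinusLeaf T o w → S,
      MeasurableSet {f : V → S | (fun v : starMinusLeaf T o w => f v) = y} := fun y =>
    (show Measurable fun (f : V → S) (v : starMinusLeaf T o w) => f v from
      measurable_pi_lambda _ fun v => measurable_pi_apply _) (measurableSet_singleton y)
  have hnbr : ∀ j : starMinusLeaf T o w, j ≠ ⟨o, ho⟩ → T.Adj o j := by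
    rintro ⟨j, hj1 | hj1, hj2⟩ hj
    · exact absurd (Subtype.ext hj1) hj
    · exact hj1
  have hJ : Fintype.card (starMinusLeaf T o w) = d := by
    rw [← Nat.card_eq_fintype_card]
    exact (starMinusLeaf_card hreg how).2
  refine eq_prod_of_entropy_ge hd hJ ⟨o, ho⟩
    (P := fun y => μ.real {f | (fun v : starMinusLeaf T o w => f v) = y})
    (p := fun s => μ.real {f | f o = s}) (p₂ := fun q => μ.real {f | (f o, f w) = q})
    (fun y => measureReal_nonneg) ?_ ?_ ?_ ?_ y
  · have := sum_measureReal_fiber μ (fun f (v : starMinusLeaf T o w) => f v) hmeas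
      (fun _ => ()) ()
    simpa using this
  · intro j s
    rw [sum_measureReal_fiber μ (fun f (v : starMinusLeaf T o w) => f v) hmeas fun y => y j]
    exact measureReal_apply_eq hT hreg hμ _ _ _
  · intro j hj q
    rw [sum_measureReal_fiber μ (fun f (v : starMinusLeaf T o w) => f v) hmeas
      fun y => (y ⟨o, ho⟩, y j)]
    exact measureReal_pair_eq hT hreg hμ o ⟨j, hnbr j hj⟩ ⟨w, how⟩ q
  · refine (h.edge_entropy_le_star_entropy hT (by omega) hreg hμ o ⟨w, how⟩).trans (le_of_eq ?_)
    have hmem : ∀ w' : T.neighborSet o, (w' : V) ≠ w → (w' : V) ∈ starMinusLeaf T o w :=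
      fun w' hw' => ⟨Or.inr w'.2, hw'⟩
    -- The full star is almost surely the partial star with the missing leaf filled in by `F`. This
    -- map is injective, so the two entropies agree.
    refine sum_negMulLog_eq_of_ae_eq μ _ _ (fun y => (y ⟨o, ho⟩, fun w' : T.neighborSet o =>
      if hw' : (w' : V) = w then F y else y ⟨w', hmem w' hw'⟩)) ?_ ?_
    · intro y y' hyy
      rw [Prod.mk.injEq] at hyy
      funext j
      by_cases hj : j = ⟨o, ho⟩
      · rw [hj]; exact hyy.1
      · have hjw : (j : V) ≠ w := j.2.2
        simpa [hjw] using congrFun hyy.2 ⟨j, hnbr j hj⟩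
    · filter_upwards [hF] with f hf
      refine Prod.ext rfl (funext fun w' => ?_)
      by_cases hw' : (w' : V) = w
      · simp only [dif_pos hw']
        rw [← hf, hw']
      · simp only [dif_neg hw']

/-- A rigid process is not typical. -/
theorem IsRigid.not_isTypical {T : SimpleGraph V} [T.LocallyFinite] (hT : T.IsTree)
    {d : ℕ} (hd : 3 ≤ d) (hreg : T.IsRegularOfDegree d) {μ : Measure (V → S)}
    (hμ : μ ∈ invariantProcesses T S) (hrigid : IsRigid T μ) : ¬ IsTypical T d μ := by
  intro h
  have := hμ.1
  obtain ⟨o, w, how, ⟨F, hF⟩, hiid⟩ := hrigid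
  have hfin : Finite (starMinusLeaf T o w) := (starMinusLeaf_card hreg how).1
  have := Fintype.ofFinite (starMinusLeaf T o w)
  have hprod := h.measureReal_starMinusLeaf hT hd hreg hμ how F hF
  have hm : ∀ v : starMinusLeaf T o w, Measurable fun f : V → S => f v := fun v =>
    measurable_pi_apply _
  refine hiid ⟨?_, fun u v => ⟨(hm u).aemeasurable, (hm v).aemeasurable, ?_⟩⟩
  · rw [iIndepFun_iff_map_fun_eq_pi_map fun v => (hm v).aemeasurable]
    refine Measure.ext_of_singleton fun y => ?_
    have hprob : ∀ v : starMinusLeaf T o w, IsProbabilityMeasure (μ.map fun f => f v) := fun v =>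
      Measure.isProbabilityMeasure_map (hm v).aemeasurable
    rw [Measure.pi_singleton, Measure.map_apply (measurable_pi_lambda _ hm)
      (measurableSet_singleton y)]
    simp only [Measure.map_apply (hm _) (measurableSet_singleton _)]
    have h1 := hprod y
    -- The product formula is written with the marginal at `o`; invariance replaces it by the
    -- marginal at each vertex.
    rw [Finset.prod_congr rfl fun (j : starMinusLeaf T o w) _ =>
      measureReal_apply_eq hT hreg hμ o (j : V) (y j)] at h1
    rw [← ENNReal.toReal_eq_toReal_iff' (measure_ne_top _ _)
      (ENNReal.prod_ne_top fun _ _ => measure_ne_top _ _), ENNReal.toReal_prod]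
    exact h1
  · refine Measure.ext_of_singleton fun s => ?_
    rw [Measure.map_apply (hm u) (measurableSet_singleton _),
      Measure.map_apply (hm v) (measurableSet_singleton _),
      ← ENNReal.toReal_eq_toReal_iff' (measure_ne_top _ _) (measure_ne_top _ _)]
    exact measureReal_apply_eq hT hreg hμ u v s

end InvariantProcesses

/-! ### Eigenvector processes with finitely many values -/

section FiniteValuedEigenvectors

open scoped Classical
open SimpleGraph

/-- A typical process on a regular tree that satisfies an eigenvector equation and takes only
finitely many values is constant. -/
theorem IsTypical.ae_eq_const_of_eigenvector {V : Type*} {T : SimpleGraph V} [T.LocallyFinite]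
    (hT : T.IsTree) {d : ℕ} (hd : 3 ≤ d) (hreg : T.IsRegularOfDegree d) {S : Finset ℝ}
    {μ : Measure (V → S)} (hμ : μ ∈ invariantProcesses T S) (h : IsTypical T d μ) (lam : ℝ) (o : V)
    (heig : ∀ᵐ f ∂μ, lam * (f o : ℝ) = ∑ w ∈ T.neighborFinset o, (f w : ℝ)) :
    ∃ c : S, ∀ᵐ f ∂μ, ∀ v, f v = c := by
  have := hμ.1
  obtain ⟨f₀⟩ : Nonempty (V → S) := μ.nonempty_of_neZero
  have hdeg : (T.neighborFinset o).card = d := by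
    rw [card_neighborFinset_eq_degree, hreg o]
  obtain ⟨w, hw⟩ : (T.neighborFinset o).Nonempty := Finset.card_pos.1 (by omega)
  have how : T.Adj o w := (T.mem_neighborFinset o w).1 hw
  have hmem : ∀ v : (T.neighborFinset o).erase w, (v : V) ∈ starMinusLeaf T o w := fun v =>
    ⟨Or.inr ((T.mem_neighborFinset o v).1 (Finset.mem_of_mem_erase v.2)),
      Finset.ne_of_mem_erase v.2⟩
  have ho : o ∈ starMinusLeaf T o w := ⟨Or.inl rfl, how.ne⟩
  have hfin : Finite (starMinusLeaf T o w) := (starMinusLeaf_card hreg how).1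
  have := Fintype.ofFinite (starMinusLeaf T o w)
  -- The eigenvector equation solved for the label of `w`.
  set D : (starMinusLeaf T o w → S) → ℝ := fun y =>
    lam * (y ⟨o, ho⟩ : ℝ) - ∑ v : (T.neighborFinset o).erase w, (y ⟨v, hmem v⟩ : ℝ) with hD
  have hDae : ∀ᵐ f ∂μ, (f w : ℝ) = D fun v => f v := by
    filter_upwards [heig] with f hf
    rw [← Finset.add_sum_erase _ _ hw, ← Finset.sum_coe_sort] at hf
    simp only [hD]
    linarith
  have hprod := h.measureReal_starMinusLeaf hT hd hreg hμ how
    -- The default `f₀ o` is used only on labelings whose forced value is not in `S`, which almost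
    -- surely do not occur.
    (fun y => if hy : D y ∈ S then ⟨D y, hy⟩ else f₀ o) (by
      filter_upwards [hDae] with f hf
      have hS : (D fun v => f v) ∈ S := hf ▸ (f w).2
      rw [dif_pos hS]
      exact Subtype.ext hf)
  -- a coloring of the star whose labels are all charged forces the label of the last leaf
  have hcharged : ∀ y : starMinusLeaf T o w → S, (∀ j, 0 < μ.real {f | f o = y j}) →
      ∃ s : S, (s : ℝ) = D y ∧ 0 < μ.real {f | f o = s} := by
    intro y hy
    have hpos : 0 < μ.real {f | (fun v : starMinusLeaf T o w => f v) = y} := by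
      rw [hprod]
      exact Finset.prod_pos fun j _ => hy j
    by_contra! hno
    refine hpos.ne' ?_
    rw [measureReal_def, ENNReal.toReal_eq_zero_iff]
    left
    have hle : ∀ s : S, (s : ℝ) = D y → ∀ᵐ f ∂μ, f w ≠ s := by
      intro s hs
      have h0 := le_antisymm (hno s hs) measureReal_nonneg
      rw [measureReal_apply_eq hT hreg hμ o w s, measureReal_eq_zero_iff] at h0
      exact (measure_eq_zero_iff_ae_notMem.1 h0)
    have hall : ∀ᵐ f ∂μ, ∀ s : S, (s : ℝ) = D y → f w ≠ s := by
      rw [ae_all_iff]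
      intro s
      by_cases hs : (s : ℝ) = D y
      · filter_upwards [hle s hs] with f hf _ using hf
      · exact Eventually.of_forall fun f hs' => absurd hs' hs
    rw [measure_eq_zero_iff_ae_notMem]
    filter_upwards [hall, hDae] with f hf hfD hfy
    exact hf (f w) (by rw [hfD]; exact congrArg D hfy) rfl
  set supp : Finset S := {s | 0 < μ.real {f | f o = s}} with hsupp
  have hsum : ∑ s : S, μ.real {f | f o = s} = 1 := by
    have := sum_measureReal_fiber μ (fun f : V → S => f o) (measurableSet_apply_eq o)
      (fun _ => ()) ()
    simpa using this
  have hne : supp.Nonempty := by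
    by_contra hemp
    rw [Finset.not_nonempty_iff_eq_empty, Finset.filter_eq_empty_iff] at hemp
    have : ∑ s : S, μ.real {f | f o = s} ≤ 0 :=
      Finset.sum_nonpos fun s hs => not_lt.1 (hemp hs)
    linarith
  have hmem_supp : ∀ s, s ∈ supp ↔ 0 < μ.real {f | f o = s} := fun s => by simp [hsupp]
  have hminmax : supp.min' hne = supp.max' hne := by
    -- The test labeling has the minimum at the center and `c` on the other `d - 1` leaves. By
    -- independence it has positive probability, so the forced value lies in the support.
    have hval : ∀ c ∈ supp, ∃ s ∈ supp,
        (s : ℝ) = lam * (supp.min' hne : ℝ) - (d - 1) * (c : ℝ) := by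
      intro c hc
      obtain ⟨s, hs, hs0⟩ := hcharged (fun j => if (j : V) = o then supp.min' hne else c) (by
        intro j
        split_ifs
        · exact (hmem_supp _).1 (Finset.min'_mem _ _)
        · exact (hmem_supp _).1 hc)
      refine ⟨s, (hmem_supp s).2 hs0, ?_⟩
      have hnb : ∀ v : (T.neighborFinset o).erase w, (v : V) ≠ o := fun v =>
        ((T.mem_neighborFinset o v).1 (Finset.mem_of_mem_erase v.2)).ne'
      rw [hs]
      simp only [hD, if_true, hnb, if_false, Finset.sum_const, Finset.card_univ,
        Fintype.card_coe, Finset.card_erase_of_mem hw, hdeg, nsmul_eq_mul]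
      push_cast [show 1 ≤ d by omega]
      ring
    obtain ⟨s, hs, hs1⟩ := hval _ (supp.min'_mem hne)
    obtain ⟨t, ht, ht1⟩ := hval _ (supp.max'_mem hne)
    have h1 : (s : ℝ) ≤ (supp.max' hne : ℝ) := supp.le_max' s hs
    have h2 : (supp.min' hne : ℝ) ≤ (t : ℝ) := supp.min'_le t ht
    have h3 : (supp.min' hne : ℝ) ≤ (supp.max' hne : ℝ) := supp.min'_le_max' hne
    have hd' : (3 : ℝ) ≤ d := by exact_mod_cast hd
    -- Here s - t = (d-1)(max - min), while s ≤ max and t ≥ min. As d - 1 ≥ 2, the minimum and the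
    -- maximum coincide.
    exact Subtype.ext (le_antisymm h3 (by nlinarith))
  refine ⟨supp.max' hne, ?_⟩
  have := hT.connected.countable
  rw [ae_all_iff]
  intro v
  have hv : ∀ s : S, s ≠ supp.max' hne → ∀ᵐ f ∂μ, f v ≠ s := by
    intro s hs
    have hs' : s ∉ supp := fun hmem => hs (le_antisymm (supp.le_max' s hmem)
      (hminmax ▸ supp.min'_le s hmem))
    rw [hmem_supp, not_lt] at hs'
    have h0 := le_antisymm hs' measureReal_nonneg
    rw [measureReal_apply_eq hT hreg hμ o v s, measureReal_eq_zero_iff] at h0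
    exact measure_eq_zero_iff_ae_notMem.1 h0
  have hall : ∀ᵐ f ∂μ, ∀ s : S, s ≠ supp.max' hne → f v ≠ s := by
    rw [ae_all_iff]
    intro s
    by_cases hs : s = supp.max' hne
    · exact Eventually.of_forall fun f hs' => absurd hs hs'
    · filter_upwards [hv s hs] with f hf _ using hf
  filter_upwards [hall] with f hf
  by_contra hne'
  exact hf (f v) hne' rfl

end FiniteValuedEigenvectors

theorem proposition4p7 {V : Type*} (T : SimpleGraph V) [T.LocallyFinite] (hT : T.IsTree)
    (d : ℕ) (hd : 3 ≤ d) (hreg : T.IsRegularOfDegree d) :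
    (∀ (S : Type*) [Finite S] [MeasurableSpace S] [MeasurableSingletonClass S],
      ∀ μ ∈ invariantProcesses T S, IsRigid T μ → ¬ IsTypical T d μ) ∧
    (∀ (S : Finset ℝ), ∀ μ ∈ invariantProcesses T S, IsTypical T d μ →
      ∀ (lam : ℝ) (o : V),
        (∀ᵐ f ∂μ, lam * (f o : ℝ) = ∑ w ∈ T.neighborFinset o, (f w : ℝ)) →
        ∃ c : S, ∀ᵐ f ∂μ, ∀ v, f v = c) := by
  refine ⟨?_, fun S μ hμ htyp lam o heig =>
    htyp.ae_eq_const_of_eigenvector hT hd hreg hμ lam o heig⟩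
  intro S _ _ _ μ hμ hrigid
  have := Fintype.ofFinite S
  exact hrigid.not_isTypical hT hd hreg hμ
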